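/- **Corollary 4.3 (The gauge-invariant uniqueness theorem).** A *$k$-graph* $(\Lambda,d)$ is a countable small category $\Lambda$ with a functor $d:\Lambda\to\mathbb N^k$ such that whenever $d(\lambda)=m+n$ there are unique $\mu,\sigma\in\Lambda$ with $d(\mu)=m$, $d(\sigma)=n$ and $\lambda=\mu\sigma$. Objects $v$ are identified with their identity morphisms (the elements of degree $0$), and $r,s$ denote codomain and domain. Write $v\Lambda=\{\mu\in\Lambda: r(\mu)=v\}$ and $$\Lambda^{\min}(\lambda,\mu)=\{(\alpha,\beta):\lambda\alpha=\mu\beta,\ d(\lambda\alpha)=d(\lambda)\vee d(\mu)\},$$ where $\vee$ is the coordinatewise maximum. $\Lambda$ is *finitely aligned* if every $\Lambda^{\min}(\lambda,\mu)$ is finite (possibly empty). A set $E\subset v\Lambda$ is *exhaustive* if for every $\mu\in v\Lambda$ there is $\lambda\in E$ with $\Lambda^{\min}(\lambda,\mu)\neq\emptyset$. For finitely aligned $\Lambda$, a *Cuntz–Krieger $\Lambda$-family* is a collection $\{t_\lambda:\lambda\in\Lambda\}$ of partial isometries in a $C^*$-algebra such that 1. the $t_v$ ($v\in\Lambda^0$)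 are mutually orthogonal projections; 2. $t_\lambda t_\mu=t_{\lambda\mu}$ whenever $s(\lambda)=r(\mu)$; 3. $t_\lambda^*t_\mu=\sum_{(\alpha,\beta)\in\Lambda^{\min}(\lambda,\mu)}t_\alpha t_\beta^*$ for all $\lambda,\mu\in\Lambda$; 4. $\prod_{\lambda\in E}(t_v-t_\lambda t_\lambda^*)=0$ for every $v\in\Lambda^0$ and every finite exhaustive $E\subset v\Lambda$. Let $(\Lambda,d)$ be a finitely aligned $k$-graph. Then there exists a Cuntz–Krieger $\Lambda$-family $\{t_\lambda\}$ such that $t_v\neq0$ for every $v\in\Lambda^0$ and such that there is a strongly continuous action $\theta:\mathbb T^k\to\operatorname{Aut}\big(C^*(\{t_\lambda:\lambda\in\Lambda\})\big)$ satisfying $\theta_z(t_\lambda)=z^{d(\lambda)}t_\lambda$ for all $z\in\mathbb T^k$ and $\lambda\in\Lambda$, where $z^n=z_1^{n_1}\cdots z_k^{n_k}$. Furthermore, if $\{t_\lambda\}$ and $\{t'_\lambda\}$ are any two such families (possibly in different $C^*$-algebras), then there is a $*$-isomorphism $\varphi:C^*(\{t_\lambda\})\to C^*(\{t'_\lambda\})$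 with $\varphi(t_\lambda)=t'_\lambda$ for all $\lambda\in\Lambda$. -/

import Mathlib

open CategoryTheory

universe u w x y

/-- A `k`-graph on the small category `Λ`: the category is countable, and it carries a degree
functor `d` to the monoid `ℕ ^ k` with the unique factorisation property.

Objects of `Λ` are the vertices and morphisms are the paths.  A path `f : u ⟶ v` has source
`s(f) = u` and range `r(f) = v`; the path usually written `λ μ` (defined when `s(λ) = r(μ)`) is
`μ ≫ λ` in Mathlib's notation.  The vertex `v`, seen as a path of degree `0`, is `𝟙 v`. -/
structure KGraph (k : ℕ) (Λ : Type u) [Category.{w} Λ] where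
  countable_vertices : Countable Λ
  countable_paths : ∀ u v : Λ, Countable (u ⟶ v)
  /-- the degree of a path -/
  d : ∀ {u v : Λ}, (u ⟶ v) → (Fin k → ℕ)
  d_id : ∀ v : Λ, d (𝟙 v) = 0
  d_comp : ∀ {a b c : Λ} (f : a ⟶ b) (g : b ⟶ c), d (f ≫ g) = d f + d g
  /-- If `d(λ) = m + n`, there are unique paths `μ`, `σ` with `d(μ) = m`, `d(σ) = n` and
  `λ = μ σ`; the vertex `x` is the common value `s(μ) = r(σ)`. -/
  factorisation : ∀ {a b : Λ} (l : a ⟶ b) (m n : Fin k → ℕ), d l = m + n →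
    ∃! p : (Σ x : Λ, (x ⟶ b) × (a ⟶ x)), d p.2.1 = m ∧ d p.2.2 = n ∧ p.2.2 ≫ p.2.1 = l

namespace KGraph

variable {k : ℕ} {Λ : Type u} [Category.{w} Λ]

/-- The set `Λ^min(λ, μ)` of pairs `(α, β)` with `λ α = μ β` and `d(λ α) = d(λ) ∨ d(μ)`, for paths
with the same range.  (For paths with different ranges no such pair exists.) -/
def Lmin (G : KGraph k Λ) {a b v : Λ} (l : a ⟶ v) (m : b ⟶ v) :
    Set (Σ c : Λ, (c ⟶ a) × (c ⟶ b)) :=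
  {p | p.2.1 ≫ l = p.2.2 ≫ m ∧ G.d (p.2.1 ≫ l) = G.d l ⊔ G.d m}

/-- Any two paths have only finitely many minimal common extensions, possibly none.  (For paths
with different ranges there are none.) -/
def FinitelyAligned (G : KGraph k Λ) : Prop :=
  ∀ {a b v : Λ} (l : a ⟶ v) (m : b ⟶ v), (G.Lmin l m).Finite

/-- The type `v Λ` of all paths with range `v`. -/
abbrev PathsTo (v : Λ) : Type (max u w) := Σ a : Λ, (a ⟶ v)

/-- A set `E` of paths with range `v` is exhaustive if every path with range `v` has a common
extension with some member of `E`. -/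
def IsExhaustive (G : KGraph k Λ) {v : Λ} (E : Set (PathsTo v)) : Prop :=
  ∀ m : PathsTo v, ∃ l ∈ E, (G.Lmin l.2 m.2).Nonempty

/-- Cuntz-Krieger `Λ`-families in a (not necessarily unital) `C⋆`-algebra `A`. -/
structure IsCKFamily (G : KGraph k Λ) (hG : G.FinitelyAligned) {A : Type*}
    [NonUnitalCStarAlgebra A] (t : ∀ {u v : Λ}, (u ⟶ v) → A) : Prop where
  /-- every `t_λ` is a partial isometry -/
  partialIsometry : ∀ {a b : Λ} (l : a ⟶ b), t l * star (t l) * t l = t l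
  /-- the `t_v` are projections -/
  projection : ∀ v : Λ, IsStarProjection (t (𝟙 v))
  /-- the `t_v` are mutually orthogonal -/
  orthogonal : ∀ v v' : Λ, v ≠ v' → t (𝟙 v) * t (𝟙 v') = 0
  /-- `t_λ t_μ = t_{λ μ}` whenever `s(λ) = r(μ)` -/
  mul : ∀ {a b c : Λ} (l : b ⟶ c) (m : a ⟶ b), t l * t m = t (m ≫ l)
  /-- `t_λ⋆ t_μ = ∑ t_α t_β⋆`, summed over the pairs `(α, β)` in `Λ^min(λ, μ)` -/
  star_mul : ∀ {a b v : Λ} (l : a ⟶ v) (m : b ⟶ v),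
    star (t l) * t m = ∑ p ∈ (hG l m).toFinset, t p.2.1 * star (t p.2.2)
  /-- the same relation for paths with different ranges, when `Λ^min(λ, μ)` is empty -/
  star_mul_of_ne : ∀ {a b v v' : Λ} (l : a ⟶ v) (m : b ⟶ v'), v ≠ v' → star (t l) * t m = 0
  /-- `∏_{λ ∈ E} (t_v - t_λ t_λ⋆) = 0` for every vertex `v` and every finite exhaustive set `E` of
  paths with range `v`.  The set is given by an enumeration `E` without repetitions, and the product
  is taken in the order of the enumeration (the factors commute by the other relations).  `A` need
  not have a unit, so the product of the list is formed in the unitization, which contains `A`; as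
  an exhaustive set is never empty, it is a product of elements of `A`. -/
  prod_eq_zero : ∀ (v : Λ) (E : List (PathsTo v)), E.Nodup → G.IsExhaustive {l | l ∈ E} →
    (E.map fun l => ((t (𝟙 v) - t l.2 * star (t l.2) : A) : Unitization ℂ A)).prod = 0

section Generated

variable {A : Type*} [NonUnitalCStarAlgebra A]

/-- The `C⋆`-subalgebra `C⋆({t_λ})` of `A` generated by a family `t`: the norm closure of the
(non-unital) `⋆`-subalgebra generated by the elements `t_λ`. -/
def generated (t : ∀ {u v : Λ}, (u ⟶ v) → A) : NonUnitalStarSubalgebra ℂ A :=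
  (NonUnitalStarAlgebra.adjoin ℂ {x : A | ∃ (a b : Λ) (l : a ⟶ b), x = t l}).topologicalClosure

/-- The element `t_λ`, as an element of the `C⋆`-algebra generated by the family `t`. -/
def gen (t : ∀ {u v : Λ}, (u ⟶ v) → A) {a b : Λ} (l : a ⟶ b) : generated t :=
  ⟨t l, NonUnitalStarSubalgebra.le_topologicalClosure _
    (NonUnitalStarAlgebra.subset_adjoin ℂ _ ⟨a, b, l, rfl⟩)⟩

/-- There is a strongly continuous action `θ` of the torus `𝕋 ^ k` by `⋆`-automorphisms of
`C⋆({t_λ})` such that `θ_z (t_λ) = z ^ d(λ) t_λ`, where `z ^ n = z₁ ^ n₁ ⋯ z_k ^ n_k`. -/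
def HasGaugeAction (G : KGraph k Λ) (t : ∀ {u v : Λ}, (u ⟶ v) → A) : Prop :=
  ∃ θ : (Fin k → Circle) →* (generated t ≃⋆ₐ[ℂ] generated t),
    (∀ x : generated t, Continuous fun z => θ z x) ∧
    ∀ (z : Fin k → Circle) {a b : Λ} (l : a ⟶ b),
      θ z (gen t l) = (∏ i, (z i : ℂ) ^ G.d l i) • gen t l

end Generated

end KGraph

/-! Uniqueness. Given two families `t` and `t'`, it suffices that `‖x.1‖ = ‖x.2‖` on the `⋆`-algebra
generated by the direct sum `pair t t'`. By continuity this passes to the closure, so both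
coordinate projections are isometric there, hence isomorphisms onto `C⋆({t_λ})` and `C⋆({t'_λ})`;
one composed with the inverse of the other is the required map.

The relations show that the products `t_λ t_μ⋆` span the `⋆`-algebra, graded by `d(λ) - d(μ) ∈ ℤ ^
k`. In degree zero, `eq_zero_transfer` shows that a combination vanishing in one family vanishes in
the other. A nonzero combination is compressed on both sides by range projections and by projections
`1 - t_λ t_λ⋆`, until its coefficients are purely combinatorial. Relation 4 supplies a path that
avoids the excluded prefixes, and sandwiching by it isolates one nonzero coefficient times a vertex
projection. Every finite set of paths has a finite closure (`closure_finite`), so the degree-zero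
part is a union of finite-dimensional C⋆-algebras, on which injectivity gives equality of norms. The
C⋆-identity extends this to each homogeneous degree.

For an element with degrees in a box of radius `r`, averaging over the gauge action bounds each
homogeneous component by the whole element (`norm_component_le`), so the two norms differ by a
factor of at most `(2r+1)^k`. Passing from `x` to `x⋆ x` squares the norms and at most doubles `r`;
iterating makes the factor disappear (`le_of_pow_le_poly`). No conditional expectation is needed.

Existence. Paths act by prefixing on the maximal filters of paths, and so by partial isometries on
`ℓ²(boundary × ℤ ^ k)`. Relation 4 holds because a maximal filter meets every finite exhaustive set;
the `ℤ ^ k` coordinate records degrees, and diagonal unitaries in it implement the gauge action. -/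

namespace KGraph

variable {k : ℕ} {Λ : Type u} [Category.{w} Λ]

/-! ### Factorisation and minimal common extensions of paths. -/

section Paths

variable (G : KGraph k Λ)

/-- The degrees of the second factors agree by cancellation in `ℕ ^ k`. The conclusion is an
equality of sigma types because the middle vertex is part of the data. -/
theorem factor_unique {a b x y : Λ} {f : x ⟶ b} {g : a ⟶ x} {f' : y ⟶ b} {g' : a ⟶ y}
    (h : g ≫ f = g' ≫ f') (hd : G.d f = G.d f') :
    (⟨x, f, g⟩ : Σ x : Λ, (x ⟶ b) × (a ⟶ x)) = ⟨y, f', g'⟩ := by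
  have h1 : G.d (g ≫ f) = G.d f + G.d g := by rw [G.d_comp, add_comm]
  have h2 : G.d g' = G.d g := by
    have := G.d_comp g' f'
    rw [← h, G.d_comp, hd] at this
    exact (add_right_cancel this).symm
  exact (G.factorisation (g ≫ f) _ _ h1).unique ⟨rfl, rfl, rfl⟩ ⟨hd.symm, h2, h.symm⟩

include G in
theorem comp_right_cancel {a b x : Λ} {f : x ⟶ b} {g g' : a ⟶ x} (h : g ≫ f = g' ≫ f) :
    g = g' := by
  have := G.factor_unique h rfl
  simpa using this

theorem eq_id_of_d_eq_zero {a c : Λ} {f : c ⟶ a} (h : G.d f = 0) :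
    (⟨c, f⟩ : PathsTo a) = ⟨a, 𝟙 a⟩ := by
  have := G.factor_unique (f := f) (g := 𝟙 c) (f' := 𝟙 a) (g' := f) (by simp)
    (by rw [h, G.d_id])
  exact congrArg (fun p : Σ x : Λ, (x ⟶ a) × (c ⟶ x) => (⟨p.1, p.2.1⟩ : PathsTo a)) this

/-- Every path can be factored at any degree below its own. -/
theorem exists_factor {a b : Λ} (f : a ⟶ b) {n : Fin k → ℕ} (hn : n ≤ G.d f) :
    ∃ (x : Λ) (l : x ⟶ b) (m : a ⟶ x), G.d l = n ∧ f = m ≫ l := by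
  obtain ⟨⟨x, l, m⟩, ⟨h1, -, h2⟩, -⟩ := G.factorisation f n (G.d f - n)
    (add_tsub_cancel_of_le hn).symm
  exact ⟨x, l, m, h1, h2.symm⟩

/-- A common extension of two paths factors through a minimal one. -/
theorem exists_mem_Lmin {a b c v : Λ} {l : a ⟶ v} {m : b ⟶ v} {e : c ⟶ a} {e' : c ⟶ b}
    (h : e ≫ l = e' ≫ m) :
    ∃ p ∈ G.Lmin l m, ∃ ε : c ⟶ p.1, e = ε ≫ p.2.1 ∧ e' = ε ≫ p.2.2 := by
  have hl : G.d l ≤ G.d (e ≫ l) := by rw [G.d_comp]; exact le_add_self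
  have hm : G.d m ≤ G.d (e ≫ l) := by rw [h, G.d_comp]; exact le_add_self
  obtain ⟨x, q, ε, hq, hε⟩ := G.exists_factor (e ≫ l) (sup_le hl hm)
  obtain ⟨y, l', α, hl', rfl⟩ := G.exists_factor q (n := G.d l) (hq ▸ le_sup_left)
  obtain ⟨z, m', β, hm', hβ⟩ := G.exists_factor (α ≫ l') (n := G.d m) (hq ▸ le_sup_right)
  have h1 := G.factor_unique (f := l) (g := e) (f' := l') (g' := ε ≫ α) (by simp [hε]) hl'.symm
  have h2 := G.factor_unique (f := m) (g := e') (f' := m') (g' := ε ≫ β)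
    (by rw [← h, hε, hβ, Category.assoc]) hm'.symm
  cases h1
  cases h2
  exact ⟨⟨x, α, β⟩, ⟨hβ, hq⟩, ε, rfl, rfl⟩

theorem Lmin_nonempty_iff {a b v : Λ} {l : a ⟶ v} {m : b ⟶ v} :
    (G.Lmin l m).Nonempty ↔ ∃ (c : Λ) (e : c ⟶ a) (e' : c ⟶ b), e ≫ l = e' ≫ m := by
  constructor
  · rintro ⟨⟨c, e, e'⟩, h, -⟩
    exact ⟨c, e, e', h⟩
  · rintro ⟨c, e, e', h⟩
    obtain ⟨p, hp, -⟩ := G.exists_mem_Lmin h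
    exact ⟨p, hp⟩

theorem mem_Lmin_symm {a b c v : Λ} {l : a ⟶ v} {m : b ⟶ v} {e : c ⟶ a} {e' : c ⟶ b}
    (h : (⟨c, e, e'⟩ : Σ c : Λ, (c ⟶ a) × (c ⟶ b)) ∈ G.Lmin l m) :
    (⟨c, e', e⟩ : Σ c : Λ, (c ⟶ b) × (c ⟶ a)) ∈ G.Lmin m l :=
  ⟨h.1.symm, by
    have h2 := h.2
    have h1 := h.1
    dsimp only at h1 h2 ⊢
    rw [← h1, h2, sup_comm]⟩

/-- Paths of equal degree with a common extension agree. -/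
theorem eq_of_mem_Lmin {a b v : Λ} {l : a ⟶ v} {m : b ⟶ v} (hd : G.d l = G.d m)
    {p : Σ c : Λ, (c ⟶ a) × (c ⟶ b)} (hp : p ∈ G.Lmin l m) :
    (⟨a, l⟩ : PathsTo v) = ⟨b, m⟩ := by
  obtain ⟨c, α, β⟩ := p
  have := G.factor_unique hp.1 hd
  exact congrArg (fun p : Σ x : Λ, (x ⟶ v) × (c ⟶ x) => (⟨p.1, p.2.1⟩ : PathsTo v)) this

theorem Lmin_self {a v : Λ} (l : a ⟶ v) : G.Lmin l l = {⟨a, 𝟙 a, 𝟙 a⟩} := by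
  ext ⟨c, α, β⟩
  constructor
  · rintro ⟨h1, h2⟩
    dsimp only at h1 h2
    obtain rfl := G.comp_right_cancel h1
    rw [G.d_comp, sup_idem] at h2
    have h0 : G.d α = 0 := by simpa using h2
    have := G.eq_id_of_d_eq_zero h0
    cases this
    rfl
  · rintro ⟨⟩
    exact ⟨rfl, by simp⟩

end Paths

/-! ### Consequences of the relations in a unital `⋆`-ring. -/

/-- The algebraic part of the Cuntz-Krieger relations, for a family in a unital `⋆`-ring. -/
structure IsAlgCK (G : KGraph k Λ) (hG : G.FinitelyAligned) {R : Type*} [Ring R] [StarRing R]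
    (T : ∀ {u v : Λ}, (u ⟶ v) → R) : Prop where
  star_id : ∀ v : Λ, star (T (𝟙 v)) = T (𝟙 v)
  mul : ∀ {a b c : Λ} (l : b ⟶ c) (m : a ⟶ b), T l * T m = T (m ≫ l)
  star_mul : ∀ {a b v : Λ} (l : a ⟶ v) (m : b ⟶ v),
    star (T l) * T m = ∑ p ∈ (hG l m).toFinset, T p.2.1 * star (T p.2.2)
  star_mul_of_ne : ∀ {a b v v' : Λ} (l : a ⟶ v) (m : b ⟶ v'), v ≠ v' → star (T l) * T m = 0
  prod_eq_zero : ∀ (v : Λ) (E : List (PathsTo v)), E.Nodup → G.IsExhaustive {l | l ∈ E} →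
    (E.map fun l => T (𝟙 v) - T l.2 * star (T l.2)).prod = 0

namespace IsAlgCK

variable {G : KGraph k Λ} {hG : G.FinitelyAligned} {R : Type*} [Ring R] [StarRing R]
  {T : ∀ {u v : Λ}, (u ⟶ v) → R} (hT : G.IsAlgCK hG T)

include hT

theorem mul_id {a b : Λ} (l : a ⟶ b) : T l * T (𝟙 a) = T l := by simp [hT.mul]

theorem id_mul {a b : Λ} (l : a ⟶ b) : T (𝟙 b) * T l = T l := by simp [hT.mul]

theorem star_mul_id {a b : Λ} (l : a ⟶ b) : star (T l) * T (𝟙 b) = star (T l) := by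
  rw [← hT.star_id b, ← StarMul.star_mul, hT.id_mul]

theorem id_mul_star {a b : Λ} (l : a ⟶ b) : T (𝟙 a) * star (T l) = star (T l) := by
  rw [← hT.star_id a, ← StarMul.star_mul, hT.mul_id]

theorem star_comp {a b c : Λ} (l : b ⟶ c) (m : a ⟶ b) :
    star (T (m ≫ l)) = star (T m) * star (T l) := by
  rw [← hT.mul, StarMul.star_mul]

theorem star_mul_self {a b : Λ} (l : a ⟶ b) : star (T l) * T l = T (𝟙 a) := by
  rw [hT.star_mul]
  have : (hG l l).toFinset = {⟨a, 𝟙 a, 𝟙 a⟩} := by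
    ext p
    rw [Set.Finite.mem_toFinset, G.Lmin_self, Finset.mem_singleton, Set.mem_singleton_iff]
  rw [this, Finset.sum_singleton, hT.star_id, hT.mul]
  simp

theorem star_mul_self_assoc {a b : Λ} (l : a ⟶ b) (z : R) :
    star (T l) * (T l * z) = T (𝟙 a) * z := by
  rw [← mul_assoc, hT.star_mul_self]

theorem mul_star_mul {a b : Λ} (l : a ⟶ b) : T l * star (T l) * T l = T l := by
  rw [mul_assoc, hT.star_mul_self, hT.mul_id]

theorem star_mul_of_d_eq {a b v : Λ} {l : a ⟶ v} {m : b ⟶ v} (hd : G.d l = G.d m)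
    (hne : (⟨a, l⟩ : PathsTo v) ≠ ⟨b, m⟩) : star (T l) * T m = 0 := by
  rw [hT.star_mul]
  refine Finset.sum_eq_zero fun p hp => ?_
  rw [Set.Finite.mem_toFinset] at hp
  exact absurd (G.eq_of_mem_Lmin hd hp) hne

theorem range_mul_range {a b v : Λ} (l : a ⟶ v) (m : b ⟶ v) :
    T l * star (T l) * (T m * star (T m)) =
      ∑ p ∈ (hG l m).toFinset, T (p.2.1 ≫ l) * star (T (p.2.1 ≫ l)) := by
  calc _ = T l * (star (T l) * T m) * star (T m) := by simp only [mul_assoc]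
    _ = _ := by
      rw [hT.star_mul, Finset.mul_sum, Finset.sum_mul]
      refine Finset.sum_congr rfl fun p hp => ?_
      rw [Set.Finite.mem_toFinset] at hp
      have := hp.1
      rw [← mul_assoc, hT.mul, mul_assoc, ← hT.star_comp, this]

theorem range_mul_range_of_ne {a b v v' : Λ} (l : a ⟶ v) (m : b ⟶ v') (h : v ≠ v') :
    T l * star (T l) * (T m * star (T m)) = 0 := by
  calc _ = T l * (star (T l) * T m) * star (T m) := by simp only [mul_assoc]
    _ = _ := by rw [hT.star_mul_of_ne l m h]; simp

/-- The product of two range projections is zero or a sum of range projections, hence self-adjoint.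
-/
theorem commute_range {a b v v' : Λ} (l : a ⟶ v) (m : b ⟶ v') :
    Commute (T l * star (T l)) (T m * star (T m)) := by
  have h1 : IsSelfAdjoint (T l * star (T l) * (T m * star (T m))) := by
    by_cases h : v = v'
    · subst h
      rw [hT.range_mul_range]
      exact isSelfAdjoint_sum _ fun i _ => IsSelfAdjoint.mul_star_self _
    · rw [hT.range_mul_range_of_ne l m h]
      exact IsSelfAdjoint.zero R
  exact ((IsSelfAdjoint.mul_star_self _).commute_iff (IsSelfAdjoint.mul_star_self _)).2 h1

theorem range_mul_comp {a b v : Λ} (l : a ⟶ v) (m : b ⟶ a) :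
    T l * star (T l) * T (m ≫ l) = T (m ≫ l) := by
  rw [← hT.mul, ← mul_assoc, hT.mul_star_mul]

end IsAlgCK

/-! ### Compression by range projections and by their complements. -/

/-- The type of all paths. -/
abbrev Path (Λ : Type u) [Category.{w} Λ] : Type (max u w) := Σ a v : Λ, (a ⟶ v)

/-- The path `l` has the same range as `ζ`, and a common extension with it. -/
def Meets (G : KGraph k Λ) (l : Path Λ) {a v : Λ} (ζ : a ⟶ v) : Prop :=
  ∃ (b : Λ) (f : b ⟶ v), l = ⟨b, v, f⟩ ∧ (G.Lmin f ζ).Nonempty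

/-- The extensions `β` of `ζ` for which `ζ β` is a minimal common extension of `ζ` and `l`. -/
def extSet (G : KGraph k Λ) (l : Path Λ) {a v : Λ} (ζ : a ⟶ v) : Set (PathsTo a) :=
  {β | ∃ (b : Λ) (f : b ⟶ v), l = ⟨b, v, f⟩ ∧ ∃ p ∈ G.Lmin f ζ, β = ⟨p.1, p.2.2⟩}

theorem extSet_finite {G : KGraph k Λ} (hG : G.FinitelyAligned) (l : Path Λ) {a v : Λ}
    (ζ : a ⟶ v) : (G.extSet l ζ).Finite := by
  obtain ⟨b, v', f⟩ := l
  by_cases h : v' = v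
  · subst h
    refine ((hG f ζ).image fun p => (⟨p.1, p.2.2⟩ : PathsTo a)).subset ?_
    rintro β ⟨b', f', ⟨⟩, p, hp, rfl⟩
    exact ⟨p, hp, rfl⟩
  · convert Set.finite_empty
    ext β
    simp only [Set.mem_empty_iff_false, iff_false]
    rintro ⟨b', f', h', -⟩
    cases h'
    exact h rfl

/-- The pairs `(γ, δ)` for which `ξ γ` and `η δ` are the pair `l ε`, `m ε` for some path `ε`, of
minimal degree, unless `l ∈ N` or `m ∈ N'`. -/
def refineSet (G : KGraph k Λ) (N N' : List (Path Λ)) {a v b v' : Λ} (ξ : a ⟶ v) (η : b ⟶ v')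
    {s v₁ v₂ : Λ} (l : s ⟶ v₁) (m : s ⟶ v₂) : Set (Σ c : Λ, (c ⟶ a) × (c ⟶ b)) :=
  {q | (⟨s, v₁, l⟩ : Path Λ) ∉ N ∧ (⟨s, v₂, m⟩ : Path Λ) ∉ N' ∧ ∃ (α : a ⟶ s) (β : b ⟶ s),
    (⟨a, v₁, α ≫ l⟩ : Path Λ) = ⟨a, v, ξ⟩ ∧ (⟨b, v₂, β ≫ m⟩ : Path Λ) = ⟨b, v', η⟩ ∧
    q ∈ G.Lmin α β}

theorem refineSet_eq_Lmin (G : KGraph k Λ) {N N' : List (Path Λ)} {a b s v₁ v₂ : Λ}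
    {α : a ⟶ s} {β : b ⟶ s} {l : s ⟶ v₁} {m : s ⟶ v₂} (hl : (⟨s, v₁, l⟩ : Path Λ) ∉ N)
    (hm : (⟨s, v₂, m⟩ : Path Λ) ∉ N') :
    G.refineSet N N' (α ≫ l) (β ≫ m) l m = G.Lmin α β := by
  ext q
  constructor
  · rintro ⟨-, -, α', β', h1, h2, hq⟩
    have h1 : α' ≫ l = α ≫ l := by simpa using h1
    have h2 : β' ≫ m = β ≫ m := by simpa using h2
    obtain rfl := G.comp_right_cancel h1
    obtain rfl := G.comp_right_cancel h2
    exact hq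
  · intro hq
    exact ⟨hl, hm, α, β, rfl, rfl, hq⟩

theorem refineSet_finite {G : KGraph k Λ} (hG : G.FinitelyAligned) (N N' : List (Path Λ))
    {a v b v' : Λ} (ξ : a ⟶ v) (η : b ⟶ v') {s v₁ v₂ : Λ} (l : s ⟶ v₁) (m : s ⟶ v₂) :
    (G.refineSet N N' ξ η l m).Finite := by
  by_cases h : (G.refineSet N N' ξ η l m).Nonempty
  · obtain ⟨q, hl, hm, α, β, h1, h2, -⟩ := h
    cases h1
    cases h2
    rw [G.refineSet_eq_Lmin hl hm]
    exact hG α β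
  · rw [Set.not_nonempty_iff_eq_empty.1 h]
    exact Set.finite_empty

/-- From `ξ = l α`, `η = m β` and `d(l) = d(m)`, the degree `(d(α) ∨ d(β)) - d(α)` is the truncated
difference `d(η) - d(ξ)`. It no longer involves `l` and `m`, so the pairs coming from all terms of a
degree-zero sum have the same degrees and can be separated by orthogonality. -/
theorem d_of_mem_refineSet {G : KGraph k Λ} {N N' : List (Path Λ)}
    {a v b v' : Λ} {ξ : a ⟶ v} {η : b ⟶ v'} {s v₁ v₂ : Λ} {l : s ⟶ v₁} {m : s ⟶ v₂}
    (hd : G.d l = G.d m) {q : Σ c : Λ, (c ⟶ a) × (c ⟶ b)} (hq : q ∈ G.refineSet N N' ξ η l m) :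
    G.d q.2.1 = G.d η - G.d ξ ∧ G.d q.2.2 = G.d ξ - G.d η := by
  obtain ⟨-, -, α, β, h1, h2, h3, h4⟩ := hq
  cases h1
  cases h2
  have h5 := h4
  rw [h3, G.d_comp] at h5
  rw [G.d_comp] at h4
  simp only [G.d_comp, hd]
  constructor <;> ext i <;> have h6 := congrFun h4 i <;> have h7 := congrFun h5 i <;>
    simp only [Pi.add_apply, Pi.sup_apply, Pi.sub_apply] at h6 h7 ⊢ <;> omega

section Avoid

variable {R : Type*} [Ring R] [StarRing R]

/-- The product of the projections `1 - t_λ t_λ⋆`, for `λ` in the list `N`. -/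
def avoid (T : ∀ {u v : Λ}, (u ⟶ v) → R) (N : List (Path Λ)) : R :=
  (N.map fun l => 1 - T l.2.2 * star (T l.2.2)).prod

theorem avoid_cons (T : ∀ {u v : Λ}, (u ⟶ v) → R) (l : Path Λ) (N : List (Path Λ)) :
    avoid T (l :: N) = (1 - T l.2.2 * star (T l.2.2)) * avoid T N := by
  simp [avoid]

end Avoid

namespace IsAlgCK

variable {G : KGraph k Λ} {hG : G.FinitelyAligned} {R : Type*} [Ring R] [StarRing R]
  {T : ∀ {u v : Λ}, (u ⟶ v) → R} (hT : G.IsAlgCK hG T)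

include hT

theorem commute_avoid (N : List (Path Λ)) {a v : Λ} (l : a ⟶ v) :
    Commute (avoid T N) (T l * star (T l)) := by
  refine (Commute.list_prod_right _ _ fun z hz => ?_).symm
  obtain ⟨m, -, rfl⟩ := List.mem_map.1 hz
  exact (Commute.one_right _).sub_right (hT.commute_range l m.2.2)

theorem star_avoid (N : List (Path Λ)) : star (avoid T N) = avoid T N := by
  induction N with
  | nil => simp [avoid]
  | cons l N ih =>
    rw [avoid_cons, StarMul.star_mul, ih]
    simp only [star_sub, star_one, StarMul.star_mul, star_star]
    exact ((Commute.one_right _).sub_right (hT.commute_avoid N l.2.2)).eq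

theorem avoid_mul_comp {N : List (Path Λ)} {a b v : Λ} {l : b ⟶ v} (α : a ⟶ b)
    (hl : (⟨b, v, l⟩ : Path Λ) ∈ N) : avoid T N * T (α ≫ l) = 0 := by
  induction N with
  | nil => simp at hl
  | cons m N ih =>
    rw [avoid_cons]
    rcases List.mem_cons.1 hl with rfl | h
    · have := ((Commute.one_right _).sub_right (hT.commute_avoid N l)).eq
      rw [← this, mul_assoc, sub_mul, hT.range_mul_comp]
      simp
    · rw [mul_assoc, ih h, mul_zero]

theorem avoid_mul {N : List (Path Λ)} {b v : Λ} {l : b ⟶ v}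
    (hl : (⟨b, v, l⟩ : Path Λ) ∈ N) : avoid T N * T l = 0 := by
  simpa using hT.avoid_mul_comp (𝟙 b) hl

theorem avoid_mul_of_not_meets {N : List (Path Λ)} {a v : Λ} {ζ : a ⟶ v}
    (h : ∀ l ∈ N, ¬ G.Meets l ζ) : avoid T N * T ζ = T ζ := by
  induction N with
  | nil => simp [avoid]
  | cons l N ih =>
    rw [avoid_cons, mul_assoc, ih fun m hm => h m (List.mem_cons_of_mem _ hm), sub_mul, one_mul,
      sub_eq_self, mul_assoc]
    have hl := h l List.mem_cons_self
    obtain ⟨b, v', f⟩ := l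
    by_cases hv : v' = v
    · subst hv
      rw [hT.star_mul, Finset.sum_eq_zero, mul_zero]
      intro p hp
      rw [Set.Finite.mem_toFinset] at hp
      exact absurd ⟨b, f, rfl, p, hp⟩ hl
    · rw [hT.star_mul_of_ne _ _ hv, mul_zero]

/-- Cutting down by a range projection `p_ξ'` and by projections `1 - p_λ` decides for every
path in `M` whether it is a prefix of `ξ'` or is avoided. -/
theorem exists_split (M : List (Path Λ)) {a v : Λ} (ξ : a ⟶ v) {y : R}
    (hy : T ξ * star (T ξ) * y ≠ 0) :
    ∃ (a' : Λ) (ξ' : a' ⟶ v) (N : List (Path Λ)),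
      avoid T N * (T ξ' * star (T ξ')) * y ≠ 0 ∧
      ∀ l ∈ M, l ∈ N ∨ ∃ (b : Λ) (f : b ⟶ v) (α : a' ⟶ b), l = ⟨b, v, f⟩ ∧ ξ' = α ≫ f := by
  induction M with
  | nil => exact ⟨a, ξ, [], by simpa [avoid] using hy, by simp⟩
  | cons l M ih =>
    obtain ⟨a', ξ', N, hne, hM⟩ := ih
    -- If `p_l` kills the current cut-down of `y`, then `1 - p_l` fixes it and `l` joins `N`.
    -- Otherwise `p_l p_ξ'` is a sum of range projections of minimal common extensions, and a
    -- nonzero summand gives a longer `ξ'` with prefix `l`.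
    by_cases hl : T l.2.2 * star (T l.2.2) * (avoid T N * (T ξ' * star (T ξ')) * y) = 0
    · refine ⟨a', ξ', l :: N, ?_, ?_⟩
      · rw [avoid_cons, mul_assoc, mul_assoc, ← mul_assoc (avoid T N), sub_mul, hl]
        simpa using hne
      · intro m hm
        rcases List.mem_cons.1 hm with rfl | h
        · exact Or.inl List.mem_cons_self
        · exact (hM m h).imp_left (List.mem_cons_of_mem _)
    · obtain ⟨b, v', f⟩ := l
      have key : T f * star (T f) * (avoid T N * (T ξ' * star (T ξ')) * y) =
          avoid T N * (T f * star (T f) * (T ξ' * star (T ξ'))) * y := by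
        simp only [← mul_assoc]
        congr 3
        simpa only [← mul_assoc] using (hT.commute_avoid N f).eq.symm
      rw [key] at hl
      by_cases hv : v' = v
      · subst hv
        rw [hT.range_mul_range, Finset.mul_sum, Finset.sum_mul] at hl
        obtain ⟨p, hp, hpne⟩ := Finset.exists_ne_zero_of_sum_ne_zero hl
        rw [Set.Finite.mem_toFinset] at hp
        refine ⟨p.1, p.2.1 ≫ f, N, hpne, ?_⟩
        intro m hm
        rcases List.mem_cons.1 hm with rfl | h
        · exact Or.inr ⟨b, f, p.2.1, rfl, rfl⟩
        · refine (hM m h).imp_right ?_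
          rintro ⟨b', f', α, rfl, rfl⟩
          exact ⟨b', f', p.2.2 ≫ α, rfl, by rw [hp.1, Category.assoc]⟩
      · rw [hT.range_mul_range_of_ne _ _ hv] at hl
        simp at hl

/-- Each factor is absorbed into `Y` or, since the factors commute, into `Y'`. When the list is
exhaustive the product is zero, and so `Y * Y' = 0`. -/
theorem mul_prod_mul {w' : Λ} {Y Y' : R} (hY : Y * T (𝟙 w') = Y)
    (hY' : T (𝟙 w') * Y' = Y')
    (L : List (PathsTo w'))
    (h : ∀ β ∈ L, Y * (T β.2 * star (T β.2)) = 0 ∨ T β.2 * star (T β.2) * Y' = 0) :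
    Y * (L.map fun β => T (𝟙 w') - T β.2 * star (T β.2)).prod * Y' = Y * Y' := by
  induction L with
  | nil => simp
  | cons β L ih =>
    have ih := ih fun β' hβ' => h β' (List.mem_cons_of_mem _ hβ')
    rw [List.map_cons, List.prod_cons]
    rcases h β List.mem_cons_self with h1 | h1
    · rw [← mul_assoc, mul_sub, hY, h1, sub_zero, ih]
    · have hc : Commute (T (𝟙 w') - T β.2 * star (T β.2))
          (L.map fun β => T (𝟙 w') - T β.2 * star (T β.2)).prod := by
        refine Commute.list_prod_right _ _ fun z hz => ?_
        obtain ⟨m, -, rfl⟩ := List.mem_map.1 hz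
        have h0 : T (𝟙 w') = T (𝟙 w') * star (T (𝟙 w')) := by
          rw [hT.star_id, hT.mul, Category.id_comp]
        rw [h0]
        exact ((hT.commute_range _ _).sub_right (hT.commute_range _ _)).sub_left
          ((hT.commute_range _ _).sub_right (hT.commute_range _ _))
      rw [hc.eq, ← mul_assoc, mul_assoc, sub_mul, hY', h1, sub_zero, ih]

/-- The Cuntz-Krieger relation provides paths that avoid finitely many given ones. -/
theorem exists_avoiding {N N' : List (Path Λ)} {c v v' : Λ} {ζ : c ⟶ v} {ζ' : c ⟶ v'}
    (h : avoid T N * T ζ * (star (T ζ') * avoid T N') ≠ 0) :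
    ∃ (c' : Λ) (τ : c' ⟶ c), (∀ l ∈ N, ¬ G.Meets l (τ ≫ ζ)) ∧
      ∀ l ∈ N', ¬ G.Meets l (τ ≫ ζ') := by
  classical
  have hkill : ∀ {v : Λ} (ζ : c ⟶ v) (N : List (Path Λ)), ∀ l ∈ N, ∀ β ∈ G.extSet l ζ,
      avoid T N * T ζ * (T β.2 * star (T β.2)) = 0 := by
    rintro v ζ N l hl β ⟨b, f, rfl, p, hp, rfl⟩
    rw [← mul_assoc, mul_assoc (avoid T N), hT.mul, ← hp.1, hT.avoid_mul_comp _ hl, zero_mul]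
  have hfin : ∀ {v : Λ} (ζ : c ⟶ v) (N : List (Path Λ)), (⋃ l ∈ N, G.extSet l ζ).Finite :=
    fun ζ N => Set.Finite.biUnion (List.finite_toSet N) fun l _ => extSet_finite hG l ζ
  by_contra hno
  have hmeet : ∀ {v : Λ} (ζ : c ⟶ v) (N : List (Path Λ)), ∀ l ∈ N, ∀ τ : PathsTo c,
      G.Meets l (τ.2 ≫ ζ) → ∃ β ∈ ⋃ l ∈ N, G.extSet l ζ, (G.Lmin β.2 τ.2).Nonempty := by
    rintro v ζ N l hl ⟨c', τ⟩ ⟨b, f, rfl, ⟨e, ε, ε'⟩, hp, -⟩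
    dsimp only at hp
    rw [← Category.assoc] at hp
    obtain ⟨q, hq, δ, h1, h2⟩ := G.exists_mem_Lmin hp
    refine ⟨⟨q.1, q.2.2⟩, ?_, ?_⟩
    · simp only [Set.mem_iUnion]
      exact ⟨_, hl, b, f, rfl, q, hq, rfl⟩
    · exact G.Lmin_nonempty_iff.2 ⟨e, δ, ε', h2.symm⟩
  -- `E` consists of the `β` for which `ζ β` or `ζ' β` is a minimal common extension with a member
  -- of `N` or `N'`. If no `τ` avoids both lists, every `τ` has a common extension with some `β ∈
  -- E`, so `E` is exhaustive.
  set E : Finset (PathsTo c) := (hfin ζ N).toFinset ∪ (hfin ζ' N').toFinset with hE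
  have hex : G.IsExhaustive {l | l ∈ E.toList} := by
    intro τ
    have hτ : (∃ l ∈ N, G.Meets l (τ.2 ≫ ζ)) ∨ ∃ l ∈ N', G.Meets l (τ.2 ≫ ζ') := by
      by_contra! hh
      exact hno ⟨τ.1, τ.2, hh.1, hh.2⟩
    rcases hτ with ⟨l, hl, hm⟩ | ⟨l, hl, hm⟩
    · obtain ⟨β, hβ, h1⟩ := hmeet ζ N l hl τ hm
      exact ⟨β, by simp only [Set.mem_ofPred_eq, Finset.mem_toList, hE, Finset.mem_union,
        Set.Finite.mem_toFinset]; exact Or.inl hβ, h1⟩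
    · obtain ⟨β, hβ, h1⟩ := hmeet ζ' N' l hl τ hm
      exact ⟨β, by simp only [Set.mem_ofPred_eq, Finset.mem_toList, hE, Finset.mem_union,
        Set.Finite.mem_toFinset]; exact Or.inr hβ, h1⟩
  refine h ?_
  rw [← hT.mul_prod_mul (w' := c) ?_ ?_ E.toList, hT.prod_eq_zero c E.toList E.nodup_toList hex]
  · simp
  · intro β hβ
    simp only [Finset.mem_toList, hE, Finset.mem_union, Set.Finite.mem_toFinset,
      Set.mem_iUnion] at hβ
    rcases hβ with ⟨l, hl, hβ⟩ | ⟨l, hl, hβ⟩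
    · exact Or.inl (hkill ζ N l hl β hβ)
    · right
      have := congrArg star (hkill ζ' N' l hl β hβ)
      simpa only [StarMul.star_mul, star_star, star_zero, hT.star_avoid] using this
  · rw [mul_assoc, hT.mul_id]
  · rw [← mul_assoc, hT.id_mul_star]

/-- A term with `l ∈ N` or `m ∈ N'` is killed. Otherwise `ξ = l α` and `η = m β`, and the middle
factor reduces to `t_α⋆ t_β`, which expands over `Λ^min(α, β)`. -/
theorem split_term {N N' : List (Path Λ)} {a v b v' : Λ} {ξ : a ⟶ v} {η : b ⟶ v'}
    {s v₁ v₂ : Λ} {l : s ⟶ v₁} {m : s ⟶ v₂}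
    (hl : (⟨s, v₁, l⟩ : Path Λ) ∈ N ∨ ∃ (b : Λ) (f : b ⟶ v) (α : a ⟶ b),
      (⟨s, v₁, l⟩ : Path Λ) = ⟨b, v, f⟩ ∧ ξ = α ≫ f)
    (hm : (⟨s, v₂, m⟩ : Path Λ) ∈ N' ∨ ∃ (c : Λ) (f : c ⟶ v') (α : b ⟶ c),
      (⟨s, v₂, m⟩ : Path Λ) = ⟨c, v', f⟩ ∧ η = α ≫ f) :
    avoid T N * (T ξ * star (T ξ)) * (T l * star (T m)) * (T η * star (T η) * avoid T N') =
      ∑ q ∈ (refineSet_finite hG N N' ξ η l m).toFinset,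
        avoid T N * T (q.2.1 ≫ ξ) * (star (T (q.2.2 ≫ η)) * avoid T N') := by
  by_cases hlN : (⟨s, v₁, l⟩ : Path Λ) ∈ N
  · rw [Finset.sum_eq_zero]
    · calc _ = avoid T N * (T ξ * star (T ξ)) * T l *
            (star (T m) * (T η * star (T η) * avoid T N')) := by simp only [mul_assoc]
        _ = 0 := by
          rw [(hT.commute_avoid N ξ).eq, mul_assoc (T ξ * star (T ξ)), hT.avoid_mul hlN]
          simp
    · intro q hq
      rw [Set.Finite.mem_toFinset] at hq
      exact absurd hlN hq.1
  by_cases hmN : (⟨s, v₂, m⟩ : Path Λ) ∈ N'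
  · rw [Finset.sum_eq_zero]
    · have := congrArg star (hT.avoid_mul hmN)
      rw [StarMul.star_mul, hT.star_avoid, star_zero] at this
      calc _ = avoid T N * (T ξ * star (T ξ)) * T l *
            (star (T m) * (T η * star (T η) * avoid T N')) := by simp only [mul_assoc]
        _ = 0 := by
          rw [← (hT.commute_avoid N' η).eq, ← mul_assoc (star (T m)), this]
          simp
    · intro q hq
      rw [Set.Finite.mem_toFinset] at hq
      exact absurd hmN hq.2.1
  obtain ⟨_, f, α, h1, rfl⟩ := hl.resolve_left hlN
  obtain ⟨_, g, β, h2, rfl⟩ := hm.resolve_left hmN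
  cases h1
  cases h2
  have h1 : star (T (α ≫ f)) * T f = star (T α) := by
    rw [hT.star_comp, mul_assoc, hT.star_mul_self, hT.star_mul_id]
  have h2 : star (T g) * T (β ≫ g) = T β := by
    rw [← hT.mul, ← mul_assoc, hT.star_mul_self, hT.id_mul]
  calc _ = avoid T N * T (α ≫ f) * ((star (T (α ≫ f)) * T f) * (star (T g) * T (β ≫ g))) *
        (star (T (β ≫ g)) * avoid T N') := by simp only [mul_assoc]
    _ = _ := by
      rw [h1, h2, hT.star_mul, Finset.mul_sum, Finset.sum_mul]
      refine Finset.sum_congr ?_ fun q _ => ?_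
      · ext q
        rw [Set.Finite.mem_toFinset, Set.Finite.mem_toFinset, G.refineSet_eq_Lmin hlN hmN]
      · simp only [hT.star_comp]
        simp only [← hT.mul, mul_assoc]

-- Terms are collected by the pair `q`, since different `i` can produce the same `q`. The index set
-- and the collected coefficients do not mention `T`, so the same expansion holds in any other
-- family.
open Classical in
theorem compress_sum [Algebra ℂ R] {ι : Type*} [Fintype ι] {s v v' : ι → Λ}
    {l : ∀ i, s i ⟶ v i} {m : ∀ i, s i ⟶ v' i} (c : ι → ℂ)
    {N N' : List (Path Λ)} {a v₁ b v₂ : Λ} {ξ : a ⟶ v₁} {η : b ⟶ v₂}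
    (hl : ∀ i, (⟨s i, v i, l i⟩ : Path Λ) ∈ N ∨ ∃ (b : Λ) (f : b ⟶ v₁) (α : a ⟶ b),
      (⟨s i, v i, l i⟩ : Path Λ) = ⟨b, v₁, f⟩ ∧ ξ = α ≫ f)
    (hm : ∀ i, (⟨s i, v' i, m i⟩ : Path Λ) ∈ N' ∨ ∃ (c : Λ) (f : c ⟶ v₂) (α : b ⟶ c),
      (⟨s i, v' i, m i⟩ : Path Λ) = ⟨c, v₂, f⟩ ∧ η = α ≫ f) :
    avoid T N * (T ξ * star (T ξ)) * (∑ i, c i • (T (l i) * star (T (m i)))) *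
        (T η * star (T η) * avoid T N') =
      ∑ q ∈ Finset.univ.biUnion fun i => (refineSet_finite hG N N' ξ η (l i) (m i)).toFinset,
        (∑ i, if q ∈ (refineSet_finite hG N N' ξ η (l i) (m i)).toFinset then c i else 0) •
          (avoid T N * T (q.2.1 ≫ ξ) * (star (T (q.2.2 ≫ η)) * avoid T N')) := by
  simp only [Finset.sum_smul]
  rw [Finset.sum_comm, Finset.mul_sum, Finset.sum_mul]
  refine Finset.sum_congr rfl fun i _ => ?_
  rw [mul_smul_comm, smul_mul_assoc, hT.split_term (hl i) (hm i), Finset.smul_sum]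
  simp only [ite_smul, zero_smul]
  rw [Finset.sum_ite_mem, Finset.inter_eq_right.2]
  intro q hq
  exact Finset.mem_biUnion.2 ⟨i, Finset.mem_univ _, hq⟩

/-- `y⋆ y` is the sum of the `z_i⋆ t_i⋆ y`, and `t_i⋆ y = t_i⋆ (t_i t_i⋆ y)`. If all range
projections killed `y`, then `y⋆ y = 0`. -/
theorem exists_range_mul_ne_zero (hR : ∀ x : R, star x * x = 0 → x = 0) {ι : Type*} [Fintype ι]
    {s v : ι → Λ} (l : ∀ i, s i ⟶ v i) (z : ι → R) {y : R} (hy : y = ∑ i, T (l i) * z i)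
    (hy0 : y ≠ 0) : ∃ i, T (l i) * star (T (l i)) * y ≠ 0 := by
  by_contra! h
  refine hy0 (hR y ?_)
  conv_lhs => enter [1]; rw [hy]
  rw [star_sum, Finset.sum_mul]
  refine Finset.sum_eq_zero fun i _ => ?_
  have : star (T (l i)) * y = star (T (l i)) * (T (l i) * star (T (l i)) * y) := by
    rw [← mul_assoc, ← mul_assoc, hT.star_mul_self, hT.id_mul_star]
  rw [StarMul.star_mul, mul_assoc, this, h i]
  simp

/-- The outer paths meet nothing in `N` and `N'`, so the avoiding projections act as the identity.
What remains is `t_τ⋆ (t_γ⋆ t_γ') (t_δ'⋆ t_δ) t_τ` with `q = (γ', δ')`; paths of equal degree make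
it vanish unless `γ' = γ` and `δ' = δ`. -/
theorem compress_term {N N' : List (Path Λ)} {a v b v' c e : Λ} {ξ : a ⟶ v} {η : b ⟶ v'}
    {γ : c ⟶ a} {δ : c ⟶ b} {τ : e ⟶ c}
    (hN : ∀ l ∈ N, ¬ G.Meets l (τ ≫ γ ≫ ξ)) (hN' : ∀ l ∈ N', ¬ G.Meets l (τ ≫ δ ≫ η))
    (q : Σ c : Λ, (c ⟶ a) × (c ⟶ b)) (hq1 : G.d q.2.1 = G.d γ) (hq2 : G.d q.2.2 = G.d δ) :
    (q ≠ ⟨c, γ, δ⟩ →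
      star (T (τ ≫ γ ≫ ξ)) * (avoid T N * T (q.2.1 ≫ ξ) * (star (T (q.2.2 ≫ η)) * avoid T N')) *
        T (τ ≫ δ ≫ η) = 0) ∧
    star (T (τ ≫ γ ≫ ξ)) * (avoid T N * T (γ ≫ ξ) * (star (T (δ ≫ η)) * avoid T N')) *
      T (τ ≫ δ ≫ η) = T (𝟙 e) := by
  have h1 : star (T (τ ≫ γ ≫ ξ)) * avoid T N = star (T (τ ≫ γ ≫ ξ)) := by
    have := congrArg star (hT.avoid_mul_of_not_meets hN)
    rwa [StarMul.star_mul, hT.star_avoid] at this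
  have h2 := hT.avoid_mul_of_not_meets hN'
  have key : ∀ q : Σ c : Λ, (c ⟶ a) × (c ⟶ b),
      star (T (τ ≫ γ ≫ ξ)) * (avoid T N * T (q.2.1 ≫ ξ) * (star (T (q.2.2 ≫ η)) * avoid T N')) *
        T (τ ≫ δ ≫ η) = star (T τ) * ((star (T γ) * T q.2.1) * (star (T q.2.2) * T δ)) * T τ := by
    intro q
    calc _ = (star (T (τ ≫ γ ≫ ξ)) * avoid T N) * T (q.2.1 ≫ ξ) * star (T (q.2.2 ≫ η)) *
          (avoid T N' * T (τ ≫ δ ≫ η)) := by simp only [mul_assoc]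
      _ = _ := by
        rw [h1, h2]
        simp only [hT.star_comp]
        simp only [← hT.mul, mul_assoc, hT.star_mul_self_assoc]
        simp only [← mul_assoc, hT.id_mul]
  constructor
  · intro hne
    rw [key]
    obtain ⟨c', γ', δ'⟩ := q
    by_cases hγ : (⟨c, γ⟩ : PathsTo a) = ⟨c', γ'⟩
    · cases hγ
      have hδ : (⟨c, δ'⟩ : PathsTo b) ≠ ⟨c, δ⟩ := by
        intro h
        cases h
        exact hne rfl
      rw [hT.star_mul_of_d_eq hq2 hδ]
      simp
    · rw [hT.star_mul_of_d_eq hq1.symm hγ]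
      simp
  · rw [key ⟨c, γ, δ⟩]
    simp only [hT.star_mul_self, hT.mul_id, hT.star_mul_id]

end IsAlgCK

/-! ### Degree-zero relations pass from one family to another. -/

theorem eq_zero_transfer {G : KGraph k Λ} {hG : G.FinitelyAligned}
    {R : Type*} [Ring R] [StarRing R] [Algebra ℂ R] {T : ∀ {u v : Λ}, (u ⟶ v) → R}
    (hT : G.IsAlgCK hG T) (hR : ∀ x : R, star x * x = 0 → x = 0)
    {R' : Type*} [Ring R'] [StarRing R'] [Algebra ℂ R'] {T' : ∀ {u v : Λ}, (u ⟶ v) → R'}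
    (hT' : G.IsAlgCK hG T') (hne : ∀ v : Λ, T' (𝟙 v) ≠ 0)
    {ι : Type*} [Fintype ι] {s v v' : ι → Λ} (l : ∀ i, s i ⟶ v i) (m : ∀ i, s i ⟶ v' i)
    (c : ι → ℂ) (hd : ∀ i, G.d (l i) = G.d (m i))
    (h0 : ∑ i, c i • (T' (l i) * star (T' (m i))) = 0) :
    ∑ i, c i • (T (l i) * star (T (m i))) = 0 := by
  classical
  by_contra hx
  set X := ∑ i, c i • (T (l i) * star (T (m i))) with hX
  obtain ⟨i₀, hi₀⟩ := hT.exists_range_mul_ne_zero hR l (fun i => c i • star (T (m i))) (y := X)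
    (by simp [hX]) hx
  obtain ⟨a, ξ, N, hN, hM⟩ := hT.exists_split
    (Finset.univ.toList.map fun i => (⟨s i, v i, l i⟩ : Path Λ)) (l i₀) hi₀
  -- Taking adjoints exchanges the sides: splitting `Y` along the paths `m i` cuts `X` down on the
  -- right.
  set Y := star (avoid T N * (T ξ * star (T ξ)) * X) with hY
  have hY0 : Y ≠ 0 := by rwa [hY, Ne, star_eq_zero]
  obtain ⟨i₁, hi₁⟩ := hT.exists_range_mul_ne_zero hR m
    (fun i => star (avoid T N * (T ξ * star (T ξ)) * (c i • T (l i)))) (y := Y)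
    (by
      rw [hY, hX, Finset.mul_sum, star_sum]
      refine Finset.sum_congr rfl fun i _ => ?_
      rw [← smul_mul_assoc, ← mul_assoc, StarMul.star_mul _ (star (T (m i))), star_star]) hY0
  obtain ⟨b, η, N', hN', hM'⟩ := hT.exists_split
    (Finset.univ.toList.map fun i => (⟨s i, v' i, m i⟩ : Path Λ)) (m i₁) hi₁
  have hM : ∀ i, _ := fun i => hM ⟨s i, v i, l i⟩ (List.mem_map.2 ⟨i, by simp, rfl⟩)
  have hM' : ∀ i, _ := fun i => hM' ⟨s i, v' i, m i⟩ (List.mem_map.2 ⟨i, by simp, rfl⟩)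
  have hZ : avoid T N * (T ξ * star (T ξ)) * X * (T η * star (T η) * avoid T N') ≠ 0 := by
    intro h
    refine hN' (star_eq_zero.1 ?_)
    rw [StarMul.star_mul, StarMul.star_mul, hY, star_star, hT.star_avoid, StarMul.star_mul,
      star_star, h]
  have hexp := hT.compress_sum (fun i => c i) hM hM'
  have hexp' := hT'.compress_sum (fun i => c i) hM hM'
  rw [h0, mul_zero, zero_mul] at hexp'
  rw [hexp] at hZ
  obtain ⟨q, hq, hqne⟩ := Finset.exists_ne_zero_of_sum_ne_zero hZ
  obtain ⟨hC, hterm⟩ := smul_ne_zero_iff.1 hqne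
  have hdeg : ∀ q ∈ Finset.univ.biUnion fun i =>
      (refineSet_finite hG N N' ξ η (l i) (m i)).toFinset,
      G.d q.2.1 = G.d η - G.d ξ ∧ G.d q.2.2 = G.d ξ - G.d η := by
    intro q hq
    obtain ⟨i, -, hi⟩ := Finset.mem_biUnion.1 hq
    rw [Set.Finite.mem_toFinset] at hi
    exact d_of_mem_refineSet (hd i) hi
  obtain ⟨w', γ, δ⟩ := q
  -- The term is nonzero in `T`, and this yields a path `τ`, which is combinatorial and can be used
  -- in `T'`. Sandwiching the expansion of `0` in `T'` leaves the nonzero coefficient times the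
  -- vertex projection at `e`.
  obtain ⟨e, τ, hτ, hτ'⟩ := hT.exists_avoiding hterm
  have hd0 := hdeg _ hq
  have := congrArg (fun z => star (T' (τ ≫ γ ≫ ξ)) * z * T' (τ ≫ δ ≫ η)) hexp'
  dsimp only at this
  rw [Finset.mul_sum, Finset.sum_mul, Finset.sum_eq_single_of_mem _ hq] at this
  · rw [mul_smul_comm, smul_mul_assoc, (hT'.compress_term hτ hτ' ⟨w', γ, δ⟩ rfl rfl).2] at this
    simp only [mul_zero, zero_mul] at this
    exact smul_ne_zero hC (hne e) this.symm
  · intro q' hq' hqq'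
    have hd1 := hdeg _ hq'
    rw [mul_smul_comm, smul_mul_assoc, (hT'.compress_term hτ hτ' q' (hd1.1.trans hd0.1.symm)
      (hd1.2.trans hd0.2.symm)).1 hqq', smul_zero]

/-! ### Finite sets of paths have finite closures. -/

section Closure

/-- The smallest collection of paths that contains `E`, is closed under minimal common extensions,
and contains `l α` along with `l`, `m` and `m α` whenever `d(l) = d(m)`. -/
inductive Closure (G : KGraph k Λ) (E : Set (Path Λ)) : ∀ {a v : Λ}, (a ⟶ v) → Prop
  | base {a v : Λ} (f : a ⟶ v) : (⟨a, v, f⟩ : Path Λ) ∈ E → Closure G E f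
  | ext {a b v : Λ} (l : a ⟶ v) (m : b ⟶ v) (p : Σ c : Λ, (c ⟶ a) × (c ⟶ b)) :
      p ∈ G.Lmin l m → Closure G E l → Closure G E m → Closure G E (p.2.1 ≫ l)
  | swap {c a v v' : Λ} (l : a ⟶ v) (m : a ⟶ v') (α : c ⟶ a) : G.d l = G.d m →
      Closure G E l → Closure G E m → Closure G E (α ≫ m) → Closure G E (α ≫ l)

variable {G : KGraph k Λ}

theorem Closure.d_le {E : Set (Path Λ)} {B : Fin k → ℕ} (hB : ∀ x ∈ E, G.d x.2.2 ≤ B) {a v : Λ}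
    {f : a ⟶ v} (hf : G.Closure E f) : G.d f ≤ B := by
  induction hf with
  | base f hf => exact hB _ hf
  | ext l m p hp _ _ h1 h2 => rw [hp.2]; exact sup_le h1 h2
  | swap l m α hd _ _ _ _ _ h => rw [G.d_comp, hd, ← G.d_comp]; exact h

/-- Unique factorisation of `x` at degree `d(l)` determines `m` and `α`, so finitely many `l` and
`x` produce only finitely many swaps. -/
theorem swap_unique {a v : Λ} (l : a ⟶ v) (x : Path Λ) :
    {y : Path Λ | ∃ (c v' : Λ) (m : a ⟶ v') (α : c ⟶ a), G.d m = G.d l ∧ x = ⟨c, v', α ≫ m⟩ ∧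
      y = ⟨c, v, α ≫ l⟩}.Subsingleton := by
  rintro _ ⟨c, v', m, α, hd, rfl, rfl⟩ _ ⟨c', v'', m', α', hd', h, rfl⟩
  obtain ⟨rfl, h⟩ := Sigma.mk.inj_iff.1 h
  obtain ⟨rfl, h⟩ := Sigma.mk.inj_iff.1 (eq_of_heq h)
  have := G.factor_unique (eq_of_heq h) (hd.trans hd'.symm)
  cases this
  rfl

/-- Induction on the degree. Apart from trivial extensions, a path of degree `n` lies in `E`, is a
minimal common extension of two paths of smaller degree, or comes from such a path by a single swap.
The point is that successive swaps, which keep the degree, collapse to one. -/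
theorem closure_finite_of_d_eq (hG : G.FinitelyAligned) {E : Set (Path Λ)} (hE : E.Finite)
    (n : Fin k → ℕ) : {x : Path Λ | G.Closure E x.2.2 ∧ G.d x.2.2 = n}.Finite := by
  induction n using WellFoundedLT.induction with
  | ind n ih =>
  set L : Set (Path Λ) := {x | G.Closure E x.2.2 ∧ G.d x.2.2 < n} with hL
  have hLfin : L.Finite := by
    refine (Set.Finite.biUnion (Set.finite_Iio n) ih).subset ?_
    rintro x ⟨h1, h2⟩
    simp only [Set.mem_iUnion]
    exact ⟨_, h2, h1, rfl⟩
  set X : Set (Path Λ) := E ∪ {x | ∃ (a b v : Λ) (l : a ⟶ v) (m : b ⟶ v), ∃ p ∈ G.Lmin l m,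
    (⟨a, v, l⟩ : Path Λ) ∈ L ∧ (⟨b, v, m⟩ : Path Λ) ∈ L ∧ x = ⟨p.1, v, p.2.1 ≫ l⟩} with hX
  have hXfin : X.Finite := by
    refine hE.union ((Set.Finite.biUnion hLfin fun l _ => Set.Finite.biUnion hLfin fun m _ =>
      (extSet_finite hG m l.2.2).image fun β => (⟨β.1, l.2.1, β.2 ≫ l.2.2⟩ : Path Λ)).subset ?_)
    rintro x ⟨a, b, v, l, m, p, hp, hl, hm, rfl⟩
    simp only [Set.mem_iUnion]
    exact ⟨_, hl, _, hm, ⟨p.1, p.2.1⟩, ⟨b, m, rfl, ⟨p.1, p.2.2, p.2.1⟩, G.mem_Lmin_symm hp, rfl⟩,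
      rfl⟩
  set Y : Set (Path Λ) := X ∪ {y | ∃ (a v : Λ) (l : a ⟶ v) (x : Path Λ) (c v' : Λ) (m : a ⟶ v')
    (α : c ⟶ a), (⟨a, v, l⟩ : Path Λ) ∈ L ∧ (⟨a, v', m⟩ : Path Λ) ∈ L ∧ x ∈ X ∧ G.d m = G.d l ∧
      x = ⟨c, v', α ≫ m⟩ ∧ y = ⟨c, v, α ≫ l⟩} with hY
  have hYfin : Y.Finite := by
    refine hXfin.union ((Set.Finite.biUnion hLfin fun l _ => Set.Finite.biUnion hXfin fun x _ =>
      (swap_unique (G := G) l.2.2 x).finite).subset ?_)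
    rintro y ⟨a, v, l, x, c, v', m, α, hl, hm, hx, hd, h1, h2⟩
    simp only [Set.mem_iUnion]
    exact ⟨_, hl, _, hx, c, v', m, α, hd, h1, h2⟩
  refine hYfin.subset ?_
  suffices h : ∀ {a v : Λ} (f : a ⟶ v), G.Closure E f → G.d f = n → (⟨a, v, f⟩ : Path Λ) ∈ Y by
    rintro ⟨a, v, f⟩ ⟨h1, h2⟩
    exact h f h1 h2
  have hlow : ∀ {a c v : Λ} {l : a ⟶ v} {α : c ⟶ a}, G.d (α ≫ l) = n → G.d l = n ∨ G.d l < n :=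
    fun h => (show _ ≤ n by rw [← h, G.d_comp]; exact le_add_self).eq_or_lt
  have hid : ∀ {a c v : Λ} {l : a ⟶ v} {α : c ⟶ a}, G.d (α ≫ l) = n → G.d l = n →
      (⟨c, α⟩ : PathsTo a) = ⟨a, 𝟙 a⟩ := by
    intro a c v l α h1 h2
    apply G.eq_id_of_d_eq_zero
    rw [G.d_comp, h2] at h1
    simpa using h1
  intro a v f hf
  induction hf with
  | base f hf => exact fun _ => Or.inl (Or.inl hf)
  | @ext a b v l m p hp hl hm ihl ihm =>
    intro hn
    rcases hlow hn with h | h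
    · obtain ⟨c, α, β⟩ := p
      have key : (⟨c, α⟩ : PathsTo a) = ⟨a, 𝟙 a⟩ := hid hn h
      cases key
      simpa using ihl h
    have hn' := hn
    rw [hp.1] at hn'
    rcases hlow hn' with h' | h'
    · obtain ⟨c, α, β⟩ := p
      have key : (⟨c, β⟩ : PathsTo b) = ⟨b, 𝟙 b⟩ := hid hn' h'
      cases key
      have := hp.1
      dsimp only at this ⊢
      rw [this]
      simpa using ihm h'
    · exact Or.inl (Or.inr ⟨a, b, v, l, m, p, hp, ⟨hl, h⟩, ⟨hm, h'⟩, rfl⟩)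
  | @swap c a v v' l m α hd hl hm hα ihl ihm ihα =>
    intro hn
    rcases hlow hn with h | h
    · cases hid hn h
      simpa using ihl h
    have hn' : G.d (α ≫ m) = n := by rw [G.d_comp, ← hd, ← G.d_comp, hn]
    have hl' : (⟨a, v, l⟩ : Path Λ) ∈ L := ⟨hl, h⟩
    have hm' : (⟨a, v', m⟩ : Path Λ) ∈ L := ⟨hm, by rw [← hd]; exact h⟩
    rcases ihα hn' with hx | ⟨a', _, l', x, c', v'', m', α', hl'', hm'', hx, hd', rfl, h2⟩
    · exact Or.inr ⟨a, v, l, _, c, v', m, α, hl', hm', hx, hd.symm, rfl, rfl⟩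
    · obtain ⟨rfl, h2⟩ := Sigma.mk.inj_iff.1 h2
      obtain ⟨rfl, h2⟩ := Sigma.mk.inj_iff.1 (eq_of_heq h2)
      -- Two successive swaps lead from `m' α'` to `l' α' = m α` and on to `l α`. With `m γ = l' γ'`
      -- minimal, `α = γ ε` and `α' = γ' ε`, a single swap leads from `m' γ' ε` to `l γ ε` if `d(l
      -- γ) < n`. If `d(l γ) = n`, then `ε` is a vertex and `m α` is itself a minimal extension of
      -- shorter paths.
      obtain ⟨⟨e, γ, γ'⟩, hp, ε, rfl, rfl⟩ := G.exists_mem_Lmin (eq_of_heq h2)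
      dsimp only at *
      have hpe := hp.1
      dsimp only at hpe
      have hcm : G.Closure E (γ ≫ m) := Closure.ext m l' _ hp hm hl''.1
      have hcl : G.Closure E (γ ≫ l) := Closure.swap l m γ hd hl hm hcm
      have hcl' : G.Closure E (γ' ≫ l') := hpe ▸ hcm
      have hcm' : G.Closure E (γ' ≫ m') := Closure.swap m' l' γ' hd' hm''.1 hl''.1 hcl'
      have hd1 : G.d (γ ≫ m) = G.d (γ ≫ l) := by rw [G.d_comp, G.d_comp, hd]
      have hd2 : G.d (γ' ≫ m') = G.d (γ ≫ l) := by
        rw [G.d_comp, hd', ← G.d_comp, ← hpe, hd1]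
      simp only [Category.assoc] at hn ⊢
      rcases hlow hn with h3 | h3
      · cases hid hn h3
        simp only [Category.id_comp]
        exact Or.inr ⟨a, v, l, _, _, v', m, γ, hl', hm',
          Or.inr ⟨a, a', v', m, l', _, hp, hm', hl'', rfl⟩, hd.symm, rfl, rfl⟩
      · refine Or.inr ⟨e, v, γ ≫ l, _, _, v'', γ' ≫ m', ε, ⟨hcl, h3⟩, ⟨hcm', by
          dsimp only; rw [hd2]; exact h3⟩, hx, hd2, by simp, by simp⟩

theorem closure_finite (hG : G.FinitelyAligned) {E : Set (Path Λ)} (hE : E.Finite) :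
    {x : Path Λ | G.Closure E x.2.2}.Finite := by
  obtain ⟨B, hB⟩ := (hE.image fun x => G.d x.2.2).bddAbove
  refine (Set.Finite.biUnion (Set.finite_Iic B) fun n _ =>
    closure_finite_of_d_eq hG hE n).subset ?_
  intro x hx
  simp only [Set.mem_iUnion]
  exact ⟨_, hx.d_le fun y hy => hB ⟨y, hy, rfl⟩, hx, rfl⟩

end Closure

/-! ### Graded spans of monomials and finite-dimensional core algebras. -/

/-- The Cuntz-Krieger relations without the last one, in a `⋆`-ring that need not be unital. -/
structure IsToeplitz (G : KGraph k Λ) (hG : G.FinitelyAligned) {A : Type*} [NonUnitalRing A]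
    [StarRing A] (t : ∀ {u v : Λ}, (u ⟶ v) → A) : Prop where
  star_id : ∀ v : Λ, star (t (𝟙 v)) = t (𝟙 v)
  mul : ∀ {a b c : Λ} (l : b ⟶ c) (m : a ⟶ b), t l * t m = t (m ≫ l)
  star_mul : ∀ {a b v : Λ} (l : a ⟶ v) (m : b ⟶ v),
    star (t l) * t m = ∑ p ∈ (hG l m).toFinset, t p.2.1 * star (t p.2.2)
  star_mul_of_ne : ∀ {a b v v' : Λ} (l : a ⟶ v) (m : b ⟶ v'), v ≠ v' → star (t l) * t m = 0

theorem IsCKFamily.isToeplitz {G : KGraph k Λ} {hG : G.FinitelyAligned} {A : Type*}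
    [NonUnitalCStarAlgebra A] {t : ∀ {u v : Λ}, (u ⟶ v) → A} (ht : G.IsCKFamily hG t) :
    G.IsToeplitz hG t where
  star_id v := (ht.projection v).isSelfAdjoint
  mul := ht.mul
  star_mul := ht.star_mul
  star_mul_of_ne := ht.star_mul_of_ne

/-- The unitization provides the unit needed to form the projections `1 - t_λ t_λ⋆`. -/
theorem IsCKFamily.isAlgCK {G : KGraph k Λ} {hG : G.FinitelyAligned} {A : Type*}
    [NonUnitalCStarAlgebra A] {t : ∀ {u v : Λ}, (u ⟶ v) → A} (ht : G.IsCKFamily hG t) :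
    G.IsAlgCK hG (fun {u v} (l : u ⟶ v) => (t l : Unitization ℂ A)) where
  star_id v := by rw [← Unitization.inr_star, (ht.projection v).isSelfAdjoint.star_eq]
  mul l m := by rw [← Unitization.inr_mul, ht.mul]
  star_mul l m := by
    rw [← Unitization.inr_star, ← Unitization.inr_mul, ht.star_mul]
    simp only [← Unitization.inr_star, ← Unitization.inr_mul]
    exact map_sum (Unitization.inrNonUnitalStarAlgHom ℂ A) _ _
  star_mul_of_ne l m h := by
    rw [← Unitization.inr_star, ← Unitization.inr_mul, ht.star_mul_of_ne l m h,
      Unitization.inr_zero]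
  prod_eq_zero v E hE hex := by
    rw [← ht.prod_eq_zero v E hE hex]
    simp only [Unitization.inr_sub, Unitization.inr_mul, Unitization.inr_star]

theorem inr_sum_smul {C : Type*} [NonUnitalCStarAlgebra C] {ι : Type*} [Fintype ι] (c : ι → ℂ)
    (f : ι → C) :
    ((∑ i, c i • f i : C) : Unitization ℂ C) = ∑ i, c i • (f i : Unitization ℂ C) := by
  refine (map_sum (Unitization.inrNonUnitalStarAlgHom ℂ C) _ _).trans ?_
  exact Finset.sum_congr rfl fun i _ => Unitization.inr_smul _ _ _

theorem IsCKFamily.eq_zero_transfer {G : KGraph k Λ} {hG : G.FinitelyAligned}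
    {A : Type*} [NonUnitalCStarAlgebra A] {t : ∀ {u v : Λ}, (u ⟶ v) → A}
    (ht : G.IsCKFamily hG t)
    {B : Type*} [NonUnitalCStarAlgebra B] {t' : ∀ {u v : Λ}, (u ⟶ v) → B}
    (ht' : G.IsCKFamily hG t') (hne : ∀ v : Λ, t' (𝟙 v) ≠ 0)
    {ι : Type*} [Fintype ι] {s v v' : ι → Λ} (l : ∀ i, s i ⟶ v i) (m : ∀ i, s i ⟶ v' i)
    (c : ι → ℂ) (hd : ∀ i, G.d (l i) = G.d (m i))
    (h0 : ∑ i, c i • (t' (l i) * star (t' (m i))) = 0) :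
    ∑ i, c i • (t (l i) * star (t (m i))) = 0 := by
  refine Unitization.inr_injective (R := ℂ) ?_
  rw [inr_sum_smul, Unitization.inr_zero]
  have h := KGraph.eq_zero_transfer ht.isAlgCK (fun _ => CStarRing.star_mul_self_eq_zero_iff _ |>.1)
    ht'.isAlgCK (fun v h => hne v (Unitization.inr_injective (R := ℂ) (by simpa using h))) l m c hd
    (by
      have := congrArg (Unitization.inr (R := ℂ)) h0
      rw [inr_sum_smul, Unitization.inr_zero] at this
      simpa only [Unitization.inr_mul, Unitization.inr_star] using this)
  simpa only [Unitization.inr_mul, Unitization.inr_star] using h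

/-- The degree of a path, as an element of `ℤ ^ k`. -/
def degZ (G : KGraph k Λ) {a v : Λ} (l : a ⟶ v) : Fin k → ℤ := fun i => (G.d l i : ℤ)

theorem degZ_comp (G : KGraph k Λ) {a b c : Λ} (f : a ⟶ b) (g : b ⟶ c) :
    G.degZ (f ≫ g) = G.degZ f + G.degZ g := by
  ext i
  simp [degZ, G.d_comp]

theorem degZ_sub_eq_zero (G : KGraph k Λ) {a v v' : Λ} {l : a ⟶ v} {m : a ⟶ v'} :
    G.degZ l - G.degZ m = 0 ↔ G.d l = G.d m := by
  rw [sub_eq_zero]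
  constructor
  · intro h
    ext i
    exact Nat.cast_injective (congrFun h i)
  · intro h
    ext i
    simp [degZ, h]

section Span

variable {A : Type*} [NonUnitalCStarAlgebra A]

/-- The span of the elements `t_λ t_μ⋆` with `d(λ) - d(μ) ∈ S`. -/
def degSpan (G : KGraph k Λ) (t : ∀ {u v : Λ}, (u ⟶ v) → A) (S : Set (Fin k → ℤ)) :
    Submodule ℂ A :=
  Submodule.span ℂ {x | ∃ (a v v' : Λ) (l : a ⟶ v) (m : a ⟶ v'),
    G.degZ l - G.degZ m ∈ S ∧ x = t l * star (t m)}

variable {G : KGraph k Λ} {hG : G.FinitelyAligned} {t : ∀ {u v : Λ}, (u ⟶ v) → A}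

theorem IsToeplitz.monomial_mul (ht : G.IsToeplitz hG t) {a v v' b u' : Λ} (l : a ⟶ v)
    (m : a ⟶ v') (l' : b ⟶ v') (m' : b ⟶ u') :
    t l * star (t m) * (t l' * star (t m')) =
      ∑ p ∈ (hG m l').toFinset, t (p.2.1 ≫ l) * star (t (p.2.2 ≫ m')) := by
  calc _ = t l * (star (t m) * t l') * star (t m') := by simp only [mul_assoc]
    _ = _ := by
      rw [ht.star_mul, Finset.mul_sum, Finset.sum_mul]
      refine Finset.sum_congr rfl fun p _ => ?_
      rw [← ht.mul l, ← ht.mul m', StarMul.star_mul]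
      simp only [mul_assoc]

theorem IsToeplitz.monomial_mul_of_ne (ht : G.IsToeplitz hG t) {a v v' b u u' : Λ} (l : a ⟶ v)
    (m : a ⟶ v') (l' : b ⟶ u) (m' : b ⟶ u') (h : v' ≠ u) :
    t l * star (t m) * (t l' * star (t m')) = 0 := by
  calc _ = t l * (star (t m) * t l') * star (t m') := by simp only [mul_assoc]
    _ = _ := by simp [ht.star_mul_of_ne _ _ h]

theorem IsToeplitz.mul_mem_degSpan (ht : G.IsToeplitz hG t) {S S' U : Set (Fin k → ℤ)}
    (hU : ∀ n ∈ S, ∀ n' ∈ S', n + n' ∈ U) {x y : A} (hx : x ∈ G.degSpan t S)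
    (hy : y ∈ G.degSpan t S') : x * y ∈ G.degSpan t U := by
  induction hx using Submodule.span_induction with
  | zero => simp
  | add x x' _ _ h h' => rw [add_mul]; exact add_mem h h'
  | smul c x _ h => rw [smul_mul_assoc]; exact Submodule.smul_mem _ _ h
  | mem x hx =>
    obtain ⟨a, v, v', l, m, hd, rfl⟩ := hx
    induction hy using Submodule.span_induction with
    | zero => simp
    | add x x' _ _ h h' => rw [mul_add]; exact add_mem h h'
    | smul c x _ h => rw [mul_smul_comm]; exact Submodule.smul_mem _ _ h
    | mem y hy =>
      obtain ⟨b, w, w', l', m', hd', rfl⟩ := hy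
      by_cases h : v' = w
      · subst h
        rw [ht.monomial_mul]
        refine sum_mem fun p hp => Submodule.subset_span
          ⟨p.1, v, w', p.2.1 ≫ l, p.2.2 ≫ m', ?_, rfl⟩
        rw [Set.Finite.mem_toFinset] at hp
        have h1 := congrArg G.degZ hp.1
        rw [G.degZ_comp, G.degZ_comp] at h1
        convert hU _ hd _ hd' using 1
        rw [G.degZ_comp, G.degZ_comp]
        linear_combination (exp := 1) h1
      · rw [ht.monomial_mul_of_ne _ _ _ _ h]
        exact zero_mem _

theorem star_mem_degSpan {S U : Set (Fin k → ℤ)} (hU : ∀ n ∈ S, -n ∈ U) {x : A}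
    (hx : x ∈ G.degSpan t S) : star x ∈ G.degSpan t U := by
  induction hx using Submodule.span_induction with
  | zero => simp
  | add x x' _ _ h h' => rw [star_add]; exact add_mem h h'
  | smul c x _ h => rw [star_smul]; exact Submodule.smul_mem _ _ h
  | mem x hx =>
    obtain ⟨a, v, v', l, m, hd, rfl⟩ := hx
    refine Submodule.subset_span ⟨_, _, _, m, l, ?_, by simp⟩
    rw [← neg_sub]
    exact hU _ hd

theorem degSpan_mono {S U : Set (Fin k → ℤ)} (h : S ⊆ U) : G.degSpan t S ≤ G.degSpan t U := by
  refine Submodule.span_mono ?_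
  rintro x ⟨a, v, v', l, m, hd, hx⟩
  exact ⟨a, v, v', l, m, h hd, hx⟩

theorem exists_homogeneous_sum {S : Finset (Fin k → ℤ)} {x : A} (hx : x ∈ G.degSpan t ↑S) :
    ∃ f : (Fin k → ℤ) → A, (∀ n, f n ∈ G.degSpan t {n}) ∧ x = ∑ n ∈ S, f n := by
  classical
  induction hx using Submodule.span_induction with
  | zero => exact ⟨0, fun n => zero_mem _, by simp⟩
  | add x x' _ _ h h' =>
    obtain ⟨f, hf, rfl⟩ := h
    obtain ⟨f', hf', rfl⟩ := h'
    exact ⟨f + f', fun n => add_mem (hf n) (hf' n), by simp [Finset.sum_add_distrib]⟩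
  | smul c x _ h =>
    obtain ⟨f, hf, rfl⟩ := h
    exact ⟨c • f, fun n => Submodule.smul_mem _ _ (hf n), by simp [Finset.smul_sum]⟩
  | mem x hx =>
    obtain ⟨a, v, v', l, m, hd, rfl⟩ := hx
    refine ⟨fun n => if n = G.degZ l - G.degZ m then t l * star (t m) else 0, fun n => ?_, ?_⟩
    · dsimp only
      split_ifs with h
      · exact Submodule.subset_span ⟨_, _, _, l, m, h.symm, rfl⟩
      · exact zero_mem _
    · rw [Finset.sum_ite_eq' S]
      simp only [Finset.mem_coe] at hd
      simp [hd]

theorem mem_degSpan_of_map {B : Type*} [NonUnitalCStarAlgebra B] (φ : A →⋆ₙₐ[ℂ] B)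
    {S : Set (Fin k → ℤ)} {x : A} (hx : x ∈ G.degSpan t S) :
    φ x ∈ G.degSpan (fun {u v} (l : u ⟶ v) => φ (t l)) S := by
  induction hx using Submodule.span_induction with
  | zero => simp
  | add x x' _ _ h h' => rw [map_add]; exact add_mem h h'
  | smul c x _ h => rw [map_smul]; exact Submodule.smul_mem _ _ h
  | mem x hx =>
    obtain ⟨a, v, v', l, m, hd, rfl⟩ := hx
    exact Submodule.subset_span ⟨_, _, _, l, m, hd, by rw [map_mul, map_star]⟩

/-- The span of the elements `t_λ t_μ⋆` with `d(λ) = d(μ)` and `λ`, `μ` in the closure of `E`. -/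
def coreSpan (G : KGraph k Λ) (t : ∀ {u v : Λ}, (u ⟶ v) → A) (E : Set (Path Λ)) :
    Submodule ℂ A :=
  Submodule.span ℂ {x | ∃ (a v v' : Λ) (l : a ⟶ v) (m : a ⟶ v'),
    G.Closure E l ∧ G.Closure E m ∧ G.d l = G.d m ∧ x = t l * star (t m)}

theorem Closure.mono {E E' : Set (Path Λ)} (h : E ⊆ E') {a v : Λ} {l : a ⟶ v}
    (hl : G.Closure E l) : G.Closure E' l := by
  induction hl with
  | base f hf => exact Closure.base f (h hf)
  | ext l m p hp _ _ h1 h2 => exact Closure.ext l m p hp h1 h2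
  | swap l m α hd _ _ _ h1 h2 h3 => exact Closure.swap l m α hd h1 h2 h3

theorem coreSpan_mono {E E' : Set (Path Λ)} (h : E ⊆ E') :
    G.coreSpan t E ≤ G.coreSpan t E' := by
  refine Submodule.span_mono ?_
  rintro x ⟨a, v, v', l, m, hl, hm, hd, hx⟩
  exact ⟨a, v, v', l, m, hl.mono h, hm.mono h, hd, hx⟩

theorem exists_mem_coreSpan {x : A} (hx : x ∈ G.degSpan t {0}) :
    ∃ E : Set (Path Λ), E.Finite ∧ x ∈ G.coreSpan t E := by
  induction hx using Submodule.span_induction with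
  | zero => exact ⟨∅, Set.finite_empty, zero_mem _⟩
  | add x x' _ _ h h' =>
    obtain ⟨E, hE, hx⟩ := h
    obtain ⟨E', hE', hx'⟩ := h'
    exact ⟨E ∪ E', hE.union hE', add_mem (coreSpan_mono Set.subset_union_left hx)
      (coreSpan_mono Set.subset_union_right hx')⟩
  | smul c x _ h =>
    obtain ⟨E, hE, hx⟩ := h
    exact ⟨E, hE, Submodule.smul_mem _ _ hx⟩
  | mem x hx =>
    obtain ⟨a, v, v', l, m, hd, rfl⟩ := hx
    exact ⟨{⟨a, v, l⟩, ⟨a, v', m⟩}, Set.toFinite _, Submodule.subset_span ⟨a, v, v', l, m,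
      Closure.base _ (by simp), Closure.base _ (by simp), G.degZ_sub_eq_zero.1 hd, rfl⟩⟩

theorem coreSpan_le_degSpan (E : Set (Path Λ)) : G.coreSpan t E ≤ G.degSpan t {0} := by
  refine Submodule.span_mono ?_
  rintro x ⟨a, v, v', l, m, hl, hm, hd, hx⟩
  exact ⟨a, v, v', l, m, G.degZ_sub_eq_zero.2 hd, hx⟩

theorem finiteDimensional_coreSpan (hG : G.FinitelyAligned) {E : Set (Path Λ)} (hE : E.Finite) :
    FiniteDimensional ℂ (G.coreSpan t E) := by
  refine FiniteDimensional.span_of_finite ℂ ?_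
  refine ((closure_finite hG hE).image2 (fun x y : Path Λ => t x.2.2 * star (t y.2.2))
    (closure_finite hG hE)).subset ?_
  rintro x ⟨a, v, v', l, m, hl, hm, hd, rfl⟩
  exact ⟨⟨a, v, l⟩, hl, ⟨a, v', m⟩, hm, rfl⟩

/-- `coreSpan` as a `⋆`-subalgebra. -/
def IsToeplitz.coreSubalgebra (ht : G.IsToeplitz hG t) (E : Set (Path Λ)) :
    NonUnitalStarSubalgebra ℂ A :=
  { G.coreSpan t E with
    mul_mem' := by
      intro x y hx hy
      change x ∈ G.coreSpan t E at hx
      change y ∈ G.coreSpan t E at hy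
      change x * y ∈ G.coreSpan t E
      induction hx using Submodule.span_induction with
      | zero => simp
      | add x x' _ _ h h' => rw [add_mul]; exact add_mem h h'
      | smul c x _ h => rw [smul_mul_assoc]; exact Submodule.smul_mem _ _ h
      | mem x hx =>
        obtain ⟨a, v, v', l, m, hl, hm, hd, rfl⟩ := hx
        induction hy using Submodule.span_induction with
        | zero => simp
        | add x x' _ _ h h' => rw [mul_add]; exact add_mem h h'
        | smul c x _ h => rw [mul_smul_comm]; exact Submodule.smul_mem _ _ h
        | mem y hy =>
          obtain ⟨b, w, w', l', m', hl', hm', hd', rfl⟩ := hy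
          by_cases h : v' = w
          · subst h
            rw [ht.monomial_mul]
            refine sum_mem fun p hp => Submodule.subset_span ?_
            rw [Set.Finite.mem_toFinset] at hp
            -- The two closure operations are made for this product: `ext` yields the common
            -- extension of `m` and `l'`, and `swap` transports it to `l` and to `m'`.
            have h1 : G.Closure E (p.2.1 ≫ m) := Closure.ext _ _ p hp hm hl'
            have h2 : G.Closure E (p.2.2 ≫ l') := hp.1 ▸ h1
            refine ⟨p.1, v, w', p.2.1 ≫ l, p.2.2 ≫ m', Closure.swap _ _ _ hd hl hm h1,
              Closure.swap _ _ _ hd'.symm hm' hl' h2, ?_, rfl⟩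
            rw [G.d_comp, hd, ← G.d_comp, hp.1, G.d_comp, hd', ← G.d_comp]
          · rw [ht.monomial_mul_of_ne _ _ _ _ h]
            exact zero_mem _
    star_mem' := by
      intro x hx
      change x ∈ G.coreSpan t E at hx
      change star x ∈ G.coreSpan t E
      induction hx using Submodule.span_induction with
      | zero => simp
      | add x x' _ _ h h' => rw [star_add]; exact add_mem h h'
      | smul c x _ h => rw [star_smul]; exact Submodule.smul_mem _ _ h
      | mem x hx =>
        obtain ⟨a, v, v', l, m, hl, hm, hd, rfl⟩ := hx
        exact Submodule.subset_span ⟨_, _, _, m, l, hm, hl, hd.symm, by simp⟩ }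

end Span

/-! ### Equality of norms in a single degree. -/

section Pair

variable {G : KGraph k Λ} {hG : G.FinitelyAligned}
  {A : Type*} [NonUnitalCStarAlgebra A] {t : ∀ {u v : Λ}, (u ⟶ v) → A}
  {B : Type*} [NonUnitalCStarAlgebra B] {t' : ∀ {u v : Λ}, (u ⟶ v) → B}

/-- The direct sum of two families. -/
def pair (t : ∀ {u v : Λ}, (u ⟶ v) → A) (t' : ∀ {u v : Λ}, (u ⟶ v) → B) {u v : Λ}
    (l : u ⟶ v) : A × B := (t l, t' l)

theorem IsToeplitz.pair (ht : G.IsToeplitz hG t) (ht' : G.IsToeplitz hG t') :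
    G.IsToeplitz hG (KGraph.pair t t') where
  star_id v := Prod.ext (ht.star_id v) (ht'.star_id v)
  mul l m := Prod.ext (ht.mul l m) (ht'.mul l m)
  star_mul l m := Prod.ext ((ht.star_mul l m).trans (by rw [Prod.fst_sum]; rfl))
    ((ht'.star_mul l m).trans (by rw [Prod.snd_sum]; rfl))
  star_mul_of_ne l m h := Prod.ext (ht.star_mul_of_ne l m h) (ht'.star_mul_of_ne l m h)

theorem fst_eq_zero_of_snd (ht : G.IsCKFamily hG t) (ht' : G.IsCKFamily hG t')
    (hne : ∀ v : Λ, t' (𝟙 v) ≠ 0) {x : A × B} (hx : x ∈ G.degSpan (pair t t') {0})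
    (h0 : x.2 = 0) : x.1 = 0 := by
  obtain ⟨n, f, g, rfl⟩ := Submodule.mem_span_set'.1 hx
  choose a v v' l m hd hg using fun i => (g i).2
  simp only [hg, Prod.fst_sum, Prod.snd_sum] at h0 ⊢
  exact ht.eq_zero_transfer ht' hne l m f (fun i => G.degZ_sub_eq_zero.1 (hd i)) h0

theorem snd_eq_zero_of_fst (ht : G.IsCKFamily hG t) (ht' : G.IsCKFamily hG t')
    (hne : ∀ v : Λ, t (𝟙 v) ≠ 0) {x : A × B} (hx : x ∈ G.degSpan (pair t t') {0})
    (h0 : x.1 = 0) : x.2 = 0 := by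
  obtain ⟨n, f, g, rfl⟩ := Submodule.mem_span_set'.1 hx
  choose a v v' l m hd hg using fun i => (g i).2
  simp only [hg, Prod.fst_sum, Prod.snd_sum] at h0 ⊢
  exact ht'.eq_zero_transfer ht hne l m f (fun i => G.degZ_sub_eq_zero.1 (hd i)) h0

/-- The two families have the same norms on the core. -/
theorem norm_fst_eq_norm_snd_of_core (ht : G.IsCKFamily hG t) (hne : ∀ v : Λ, t (𝟙 v) ≠ 0)
    (ht' : G.IsCKFamily hG t') (hne' : ∀ v : Λ, t' (𝟙 v) ≠ 0) {x : A × B}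
    (hx : x ∈ G.degSpan (pair t t') {0}) : ‖x.1‖ = ‖x.2‖ := by
  obtain ⟨E, hE, hxE⟩ := exists_mem_coreSpan hx
  let S := (ht.isToeplitz.pair ht'.isToeplitz).coreSubalgebra E
  -- Finite dimension makes `S` closed, hence a C⋆-algebra, so that injective `⋆`-homomorphisms on
  -- it are isometric.
  have hS : IsClosed (S : Set (A × B)) := by
    have := finiteDimensional_coreSpan (t := pair t t') hG hE
    exact (G.coreSpan (pair t t') E).closed_of_finiteDimensional
  have hcore : ∀ y : S, (y : A × B) ∈ G.degSpan (pair t t') {0} := fun y =>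
    coreSpan_le_degSpan E y.2
  let φ : S →⋆ₙₐ[ℂ] A := (NonUnitalStarAlgHom.fst ℂ A B).comp
    (NonUnitalStarSubalgebraClass.subtype S)
  let ψ : S →⋆ₙₐ[ℂ] B := (NonUnitalStarAlgHom.snd ℂ A B).comp
    (NonUnitalStarSubalgebraClass.subtype S)
  have hφ : Function.Injective φ := by
    rw [injective_iff_map_eq_zero]
    intro y hy
    exact Subtype.ext (Prod.ext hy (snd_eq_zero_of_fst ht ht' hne (hcore y) hy))
  have hψ : Function.Injective ψ := by
    rw [injective_iff_map_eq_zero]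
    intro y hy
    exact Subtype.ext (Prod.ext (fst_eq_zero_of_snd ht ht' hne' (hcore y) hy) hy)
  exact (NonUnitalStarAlgHom.norm_map φ hφ ⟨x, hxE⟩).trans
    (NonUnitalStarAlgHom.norm_map ψ hψ ⟨x, hxE⟩).symm

/-- `x⋆ x` has degree zero, so the C⋆-identity reduces the claim to the core. -/
theorem norm_fst_eq_norm_snd_of_homogeneous (ht : G.IsCKFamily hG t)
    (hne : ∀ v : Λ, t (𝟙 v) ≠ 0) (ht' : G.IsCKFamily hG t') (hne' : ∀ v : Λ, t' (𝟙 v) ≠ 0)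
    {n : Fin k → ℤ} {x : A × B} (hx : x ∈ G.degSpan (pair t t') {n}) : ‖x.1‖ = ‖x.2‖ := by
  have h1 : star x * x ∈ G.degSpan (pair t t') {0} :=
    (ht.isToeplitz.pair ht'.isToeplitz).mul_mem_degSpan (S := {-n}) (S' := {n}) (by simp)
      (star_mem_degSpan (S := {n}) (by simp) hx) hx
  have h2 := norm_fst_eq_norm_snd_of_core ht hne ht' hne' h1
  rw [Prod.fst_mul, Prod.snd_mul, Prod.fst_star, Prod.snd_star, CStarRing.norm_star_mul_self,
    CStarRing.norm_star_mul_self] at h2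
  exact (mul_self_inj (norm_nonneg _) (norm_nonneg _)).1 h2

end Pair

/-! ### Gauge actions and homogeneous components. -/

section Gauge

variable {G : KGraph k Λ} {hG : G.FinitelyAligned}
  {A : Type*} [NonUnitalCStarAlgebra A] {t : ∀ {u v : Λ}, (u ⟶ v) → A}

instance isClosed_generated (t : ∀ {u v : Λ}, (u ⟶ v) → A) :
    IsClosed (generated t : Set A) :=
  NonUnitalStarSubalgebra.isClosed_topologicalClosure _

theorem mem_generated (t : ∀ {u v : Λ}, (u ⟶ v) → A) {u v : Λ} (l : u ⟶ v) :
    t l ∈ generated t := (gen t l).2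

/-- A gauge action multiplies the elements of degree `n` by `z ^ n`. -/
theorem gauge_apply_of_homogeneous {θ : (Fin k → Circle) →* (generated t ≃⋆ₐ[ℂ] generated t)}
    (hθ : ∀ (z : Fin k → Circle) {a b : Λ} (l : a ⟶ b),
      θ z (gen t l) = (∏ i, (z i : ℂ) ^ G.d l i) • gen t l)
    {n : Fin k → ℤ} {x : A} (hx : x ∈ G.degSpan t {n}) (z : Fin k → Circle) :
    ∃ h : x ∈ generated t, θ z ⟨x, h⟩ = (∏ i, (z i : ℂ) ^ n i) • ⟨x, h⟩ := by
  induction hx using Submodule.span_induction with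
  | zero => exact ⟨zero_mem _, (map_zero (θ z)).trans (smul_zero _).symm⟩
  | add x y _ _ hx hy =>
    obtain ⟨h1, h2⟩ := hx
    obtain ⟨h3, h4⟩ := hy
    refine ⟨add_mem h1 h3, ?_⟩
    have := map_add (θ z) ⟨x, h1⟩ ⟨y, h3⟩
    rw [h2, h4, ← smul_add] at this
    exact this
  | smul c x _ hx =>
    obtain ⟨h1, h2⟩ := hx
    refine ⟨SMulMemClass.smul_mem c h1, ?_⟩
    have := map_smul (θ z) c ⟨x, h1⟩
    rw [h2, smul_comm] at this
    exact this
  | mem x hx =>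
    obtain ⟨a, v, v', l, m, hd, rfl⟩ := hx
    refine ⟨mul_mem (mem_generated t l) (star_mem (mem_generated t m)), ?_⟩
    have : θ z (gen t l * star (gen t m)) = _ := map_mul _ _ _
    rw [map_star, hθ, hθ, star_smul, smul_mul_smul_comm] at this
    refine this.trans ?_
    have key : (∏ i, (z i : ℂ) ^ G.d l i) * star (∏ i, (z i : ℂ) ^ G.d m i) =
        ∏ i, (z i : ℂ) ^ n i := by
      rw [star_prod, ← Finset.prod_mul_distrib]
      refine Finset.prod_congr rfl fun i _ => ?_
      have h1 : n i = (G.d l i : ℤ) - (G.d m i : ℤ) := by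
        rw [← Set.mem_singleton_iff.1 hd]
        rfl
      rw [h1, zpow_sub₀ (Circle.coe_ne_zero _), star_pow, zpow_natCast, zpow_natCast,
        div_eq_mul_inv, ← inv_pow, ← Circle.coe_inv, Circle.coe_inv_eq_conj]
      rfl
    rw [key]
    rfl

theorem sum_zpow_eq_zero {N : ℕ} {ζ : ℂ} (hζ : IsPrimitiveRoot ζ N) {e : ℤ}
    (he : ¬ (N : ℤ) ∣ e) : ∑ j : Fin N, (ζ ^ (j : ℕ)) ^ e = 0 := by
  have h1 : ζ ^ e ≠ 1 := fun h => he ((hζ.zpow_eq_one_iff_dvd e).1 h)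
  have h2 : ∀ j : Fin N, (ζ ^ (j : ℕ)) ^ e = (ζ ^ e) ^ (j : ℕ) := by
    intro j
    rw [← zpow_natCast, ← zpow_natCast, ← zpow_mul, ← zpow_mul, mul_comm]
  simp only [h2]
  rw [Fin.sum_univ_eq_sum_range (fun j => (ζ ^ e) ^ j)]
  have h3 := mul_geom_sum (ζ ^ e) N
  have h4 : (ζ ^ e) ^ N = 1 := by
    rw [← zpow_natCast, ← zpow_mul, mul_comm, zpow_mul, zpow_natCast, hζ.pow_eq_one, one_zpow]
  rw [h4, sub_self] at h3
  exact (mul_eq_zero.1 h3).resolve_left (sub_ne_zero.2 h1)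

/-- The degrees of absolute value at most `r`. -/
noncomputable def box (k r : ℕ) : Finset (Fin k → ℤ) := Finset.Icc (fun _ => -(r : ℤ)) (fun _ => (r : ℤ))

theorem mem_box {r : ℕ} {n : Fin k → ℤ} : n ∈ box k r ↔ ∀ i, -(r : ℤ) ≤ n i ∧ n i ≤ r := by
  simp [box, Pi.le_def, forall_and]

theorem card_box (k r : ℕ) : (box k r).card = (2 * r + 1) ^ k := by
  rw [box, Pi.card_Icc]
  simp only [Int.card_Icc, Finset.prod_const, Finset.card_univ, Fintype.card_fin]
  congr 1
  omega

/-- In the presence of a gauge action, the homogeneous components of an element are bounded by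
the element. -/
theorem norm_component_le (hgauge : G.HasGaugeAction t) {r : ℕ} {f : (Fin k → ℤ) → A}
    (hf : ∀ n, f n ∈ G.degSpan t {n}) {m : Fin k → ℤ} (hm : m ∈ box k r) :
    ‖f m‖ ≤ ‖∑ n ∈ box k r, f n‖ := by
  obtain ⟨θ, -, hθ⟩ := hgauge
  -- Averaging over the `N`-th roots of unity in each coordinate plays the role of integration over
  -- the torus. Differences of coordinates of box elements lie in `[-2r, 2r]`, so `2r + 1` divides
  -- one only if it is zero.
  set N : ℕ := 2 * r + 1 with hN
  have hN0 : N ≠ 0 := by omega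
  have hζ := Complex.isPrimitiveRoot_exp N hN0
  set ζ : Circle := Circle.exp (2 * Real.pi / N) with hζdef
  have hζc : (ζ : ℂ) = Complex.exp (2 * Real.pi * Complex.I / N) := by
    rw [hζdef, Circle.coe_exp]
    congr 1
    push_cast
    ring
  rw [← hζc] at hζ
  have hgen : ∀ n, f n ∈ generated t := fun n =>
    (gauge_apply_of_homogeneous hθ (hf n) 1).1
  let F : (Fin k → ℤ) → generated t := fun n => ⟨f n, hgen n⟩
  have hF : ∀ z n, θ z (F n) = (∏ i, (z i : ℂ) ^ n i) • F n := fun z n =>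
    (gauge_apply_of_homogeneous hθ (hf n) z).2
  let z : (Fin k → Fin N) → (Fin k → Circle) := fun j i => ζ ^ (j i : ℕ)
  have hsum : ∀ n ∈ box k r, ∑ j, ∏ i, ((z j i : ℂ)) ^ (n i - m i) =
      if n = m then (N : ℂ) ^ k else 0 := by
    intro n hn
    have h1 : ∑ j, ∏ i, ((z j i : ℂ)) ^ (n i - m i) =
        ∏ i, ∑ j : Fin N, ((ζ : ℂ) ^ (j : ℕ)) ^ (n i - m i) := by
      rw [Finset.prod_univ_sum, Fintype.piFinset_univ]
      simp [z]
    rw [h1]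
    split_ifs with h
    · subst h
      simp
    · obtain ⟨i, hi⟩ := Function.ne_iff.1 h
      refine Finset.prod_eq_zero (Finset.mem_univ i) (sum_zpow_eq_zero hζ ?_)
      intro hdvd
      have h2 := mem_box.1 hn i
      have h3 := mem_box.1 hm i
      have h4 : n i - m i = 0 := by
        refine Int.eq_zero_of_abs_lt_dvd hdvd ?_
        rw [abs_lt]
        constructor <;> push_cast [hN] <;> omega
      omega
  have havg : ∑ j, (∏ i, ((z j i : ℂ)) ^ (- m i)) • θ (z j) (∑ n ∈ box k r, F n) =
      (N : ℂ) ^ k • F m := by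
    simp only [map_sum, hF, Finset.smul_sum, smul_smul, ← Finset.prod_mul_distrib]
    rw [Finset.sum_comm]
    have h1 : ∀ n ∈ box k r, ∑ j, (∏ i, (z j i : ℂ) ^ (- m i) * (z j i : ℂ) ^ n i) • F n =
        (if n = m then (N : ℂ) ^ k else 0) • F n := by
      intro n hn
      rw [← hsum n hn, Finset.sum_smul]
      refine Finset.sum_congr rfl fun j _ => ?_
      congr 1
      refine Finset.prod_congr rfl fun i _ => ?_
      rw [← zpow_add₀ (Circle.coe_ne_zero _), neg_add_eq_sub]
    rw [Finset.sum_congr rfl h1]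
    simp [ite_smul, hm]
  have hiso : ∀ (z : Fin k → Circle) (x : generated t), ‖θ z x‖ = ‖x‖ := fun z x =>
    NonUnitalStarAlgHom.norm_map (θ z) (θ z).injective x
  have hcoe : ((∑ n ∈ box k r, F n : generated t) : A) = ∑ n ∈ box k r, f n := by
    rw [AddSubmonoidClass.coe_finsetSum]
  have hle : ‖(N : ℂ) ^ k • F m‖ ≤ (N : ℝ) ^ k * ‖∑ n ∈ box k r, F n‖ := by
    rw [← havg]
    refine (norm_sum_le _ _).trans ?_
    have h2 : ∀ j, ‖(∏ i, ((z j i : ℂ)) ^ (- m i)) • θ (z j) (∑ n ∈ box k r, F n)‖ =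
        ‖∑ n ∈ box k r, F n‖ := by
      intro j
      rw [norm_smul, hiso, norm_prod, Finset.prod_eq_one, one_mul]
      intro i _
      rw [norm_zpow, Circle.norm_coe, one_zpow]
    simp only [h2]
    simp
  rw [norm_smul, norm_pow, Complex.norm_natCast] at hle
  have hpos : (0 : ℝ) < (N : ℝ) ^ k := by positivity
  have := le_of_mul_le_mul_left hle hpos
  rw [← hcoe]
  exact this

end Gauge

/-! ### Equality of norms on the generated algebra, and the isomorphism. -/

section Compare

variable {G : KGraph k Λ} {hG : G.FinitelyAligned}
  {A : Type*} [NonUnitalCStarAlgebra A] {t : ∀ {u v : Λ}, (u ⟶ v) → A}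
  {B : Type*} [NonUnitalCStarAlgebra B] {t' : ∀ {u v : Λ}, (u ⟶ v) → B}

theorem snd_mem_degSpan {S : Set (Fin k → ℤ)} {x : A × B}
    (hx : x ∈ G.degSpan (pair t t') S) : x.2 ∈ G.degSpan t' S :=
  mem_degSpan_of_map (t := pair t t') (NonUnitalStarAlgHom.snd ℂ A B) hx

theorem fst_mem_degSpan {S : Set (Fin k → ℤ)} {x : A × B}
    (hx : x ∈ G.degSpan (pair t t') S) : x.1 ∈ G.degSpan t S :=
  mem_degSpan_of_map (t := pair t t') (NonUnitalStarAlgHom.fst ℂ A B) hx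

/-- The triangle inequality runs over the `(2r+1)^k` components; each has the same norm in both
families, and in `B` it is bounded by the whole element. -/
theorem norm_fst_le_of_box (ht : G.IsCKFamily hG t)
    (hne : ∀ v : Λ, t (𝟙 v) ≠ 0) (ht' : G.IsCKFamily hG t') (hne' : ∀ v : Λ, t' (𝟙 v) ≠ 0)
    (hgauge' : G.HasGaugeAction t') {r : ℕ} {x : A × B}
    (hx : x ∈ G.degSpan (pair t t') (box k r)) :
    ‖x.1‖ ≤ (2 * r + 1) ^ k * ‖x.2‖ := by
  obtain ⟨f, hf, rfl⟩ := exists_homogeneous_sum hx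
  have h2 : ∀ n, (f n).2 ∈ G.degSpan t' {n} := fun n => snd_mem_degSpan (hf n)
  rw [Prod.fst_sum, Prod.snd_sum]
  refine (norm_sum_le _ _).trans ?_
  refine (Finset.sum_le_card_nsmul _ _ ‖∑ n ∈ box k r, (f n).2‖ fun n hn => ?_).trans ?_
  · rw [norm_fst_eq_norm_snd_of_homogeneous ht hne ht' hne' (hf n)]
    exact norm_component_le (f := fun n => (f n).2) hgauge' h2 hn
  · rw [card_box, nsmul_eq_mul]
    exact le_of_eq (by push_cast; ring)

theorem norm_snd_le_of_box (ht : G.IsCKFamily hG t)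
    (hne : ∀ v : Λ, t (𝟙 v) ≠ 0) (hgauge : G.HasGaugeAction t)
    (ht' : G.IsCKFamily hG t') (hne' : ∀ v : Λ, t' (𝟙 v) ≠ 0) {r : ℕ} {x : A × B}
    (hx : x ∈ G.degSpan (pair t t') (box k r)) :
    ‖x.2‖ ≤ (2 * r + 1) ^ k * ‖x.1‖ := by
  obtain ⟨f, hf, rfl⟩ := exists_homogeneous_sum hx
  have h2 : ∀ n, (f n).1 ∈ G.degSpan t {n} := fun n => fst_mem_degSpan (hf n)
  rw [Prod.fst_sum, Prod.snd_sum]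
  refine (norm_sum_le _ _).trans ?_
  refine (Finset.sum_le_card_nsmul _ _ ‖∑ n ∈ box k r, (f n).1‖ fun n hn => ?_).trans ?_
  · rw [← norm_fst_eq_norm_snd_of_homogeneous ht hne ht' hne' (hf n)]
    exact norm_component_le (f := fun n => (f n).1) hgauge h2 hn
  · rw [card_box, nsmul_eq_mul]
    exact le_of_eq (by push_cast; ring)

/-- A bound that grows polynomially under iterated squaring can be improved to a contraction. -/
theorem le_of_pow_le_poly {a b : ℝ} (ha : 0 ≤ a) (hb : 0 ≤ b) (k r : ℕ)
    (h : ∀ j : ℕ, a ^ 2 ^ j ≤ (2 * ((2 ^ j * r : ℕ) : ℝ) + 1) ^ k * b ^ 2 ^ j) : a ≤ b := by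
  by_contra! hlt
  have ha' : 0 < a := hb.trans_lt hlt
  have hc : |b / a| < 1 := by
    rw [abs_of_nonneg (div_nonneg hb ha), div_lt_one ha']
    exact hlt
  -- If `b < a`, then `n^k (b/a)^n` tends to `0`. Along `n = 2^j` this contradicts the hypothesis,
  -- because `2 · 2^j r + 1 ≤ (2r + 1) 2^j`.
  have h1 := (tendsto_pow_const_mul_const_pow_of_abs_lt_one k hc).const_mul ((2 * r + 1 : ℝ) ^ k)
  rw [mul_zero] at h1
  have h2 := h1.comp (tendsto_pow_atTop_atTop_of_one_lt (r := 2) (by norm_num))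
  obtain ⟨j, hj⟩ := (h2.eventually_lt_const one_pos).exists
  dsimp at hj
  refine absurd hj (not_lt.2 ?_)
  have hapos : 0 < a ^ 2 ^ j := by positivity
  have h3 : 1 ≤ (2 * ((2 ^ j * r : ℕ) : ℝ) + 1) ^ k * (b / a) ^ 2 ^ j := by
    rw [div_pow, ← mul_div_assoc, le_div_iff₀ hapos, one_mul]
    exact h j
  refine h3.trans ?_
  rw [← mul_assoc, ← mul_pow]
  have h4 : (1 : ℝ) ≤ 2 ^ j := one_le_pow₀ (by norm_num)
  have h5 : 0 ≤ b / a := div_nonneg hb ha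
  gcongr
  push_cast
  nlinarith

/-- The sequence starting from `x` in which each `y` is followed by `y⋆ y`. -/
def iterSq {C : Type*} [Mul C] [Star C] (x : C) : ℕ → C
  | 0 => x
  | j + 1 => star (iterSq x j) * iterSq x j

theorem norm_iterSq {C : Type*} [NonUnitalCStarAlgebra C] (x : C) (j : ℕ) :
    ‖iterSq x j‖ = ‖x‖ ^ 2 ^ j := by
  induction j with
  | zero => simp [iterSq]
  | succ j ih =>
    rw [iterSq, CStarRing.norm_star_mul_self, ih, ← pow_two, ← pow_mul, pow_succ]

theorem fst_iterSq (x : A × B) (j : ℕ) : (iterSq x j).1 = iterSq x.1 j := by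
  induction j with
  | zero => rfl
  | succ j ih => simp [iterSq, ih]

theorem snd_iterSq (x : A × B) (j : ℕ) : (iterSq x j).2 = iterSq x.2 j := by
  induction j with
  | zero => rfl
  | succ j ih => simp [iterSq, ih]

/-- The degrees of `y⋆ y` are differences of degrees of `y`, so each step at most doubles the
radius. -/
theorem IsToeplitz.iterSq_mem (ht : G.IsToeplitz hG t) {r : ℕ} {x : A}
    (hx : x ∈ G.degSpan t (box k r)) (j : ℕ) : iterSq x j ∈ G.degSpan t (box k (2 ^ j * r)) := by
  induction j with
  | zero => simpa [iterSq] using hx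
  | succ j ih =>
    refine ht.mul_mem_degSpan (S := box k (2 ^ j * r)) (S' := box k (2 ^ j * r)) ?_
      (star_mem_degSpan ?_ ih) ih
    · intro n hn n' hn'
      rw [Finset.mem_coe, mem_box] at hn hn' ⊢
      intro i
      have h1 := hn i
      have h2 := hn' i
      have h3 : 2 ^ (j + 1) * r = 2 ^ j * r + 2 ^ j * r := by ring
      rw [h3, Nat.cast_add, Pi.add_apply]
      constructor <;> linarith
    · intro n hn
      rw [Finset.mem_coe, mem_box] at hn ⊢
      intro i
      have h1 := hn i
      rw [Pi.neg_apply]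
      constructor <;> linarith

theorem norm_fst_eq_norm_snd_of_mem_box (ht : G.IsCKFamily hG t)
    (hne : ∀ v : Λ, t (𝟙 v) ≠ 0) (hgauge : G.HasGaugeAction t)
    (ht' : G.IsCKFamily hG t') (hne' : ∀ v : Λ, t' (𝟙 v) ≠ 0) (hgauge' : G.HasGaugeAction t')
    {r : ℕ} {x : A × B} (hx : x ∈ G.degSpan (pair t t') (box k r)) : ‖x.1‖ = ‖x.2‖ := by
  have hmem := (ht.isToeplitz.pair ht'.isToeplitz).iterSq_mem hx
  refine le_antisymm (le_of_pow_le_poly (norm_nonneg _) (norm_nonneg _) k r fun j => ?_)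
    (le_of_pow_le_poly (norm_nonneg _) (norm_nonneg _) k r fun j => ?_)
  · have := norm_fst_le_of_box ht hne ht' hne' hgauge' (hmem j)
    rwa [fst_iterSq, snd_iterSq, norm_iterSq, norm_iterSq] at this
  · have := norm_snd_le_of_box ht hne hgauge ht' hne' (hmem j)
    rwa [fst_iterSq, snd_iterSq, norm_iterSq, norm_iterSq] at this

theorem exists_mem_box (n : Fin k → ℤ) : ∃ r, n ∈ box k r := by
  refine ⟨∑ i, (n i).natAbs, mem_box.2 fun i => ?_⟩
  have : (n i).natAbs ≤ ∑ i, (n i).natAbs :=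
    Finset.single_le_sum (f := fun i => (n i).natAbs) (fun _ _ => Nat.zero_le _)
      (Finset.mem_univ i)
  omega

theorem box_mono {r r' : ℕ} (h : r ≤ r') : (box k r : Set (Fin k → ℤ)) ⊆ box k r' := by
  intro n hn
  rw [Finset.mem_coe, mem_box] at hn ⊢
  intro i
  have := hn i
  omega

/-- Every element of the `⋆`-algebra generated by the family has bounded degrees. -/
theorem IsToeplitz.exists_mem_degSpan_box (ht : G.IsToeplitz hG t) {x : A}
    (hx : x ∈ NonUnitalStarAlgebra.adjoin ℂ {x : A | ∃ (a b : Λ) (l : a ⟶ b), x = t l}) :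
    ∃ r, x ∈ G.degSpan t (box k r) := by
  have huniv : x ∈ G.degSpan t Set.univ := by
    induction hx using NonUnitalStarAlgebra.adjoin_induction with
    | mem x hx =>
      obtain ⟨a, b, l, rfl⟩ := hx
      exact Submodule.subset_span ⟨a, b, a, l, 𝟙 a, trivial, by
        rw [ht.star_id, ht.mul, Category.id_comp]⟩
    | add x y _ _ h h' => exact add_mem h h'
    | zero => exact zero_mem _
    | mul x y _ _ h h' => exact ht.mul_mem_degSpan (by simp) h h'
    | smul c x _ h => exact Submodule.smul_mem _ _ h
    | star x _ h => exact star_mem_degSpan (by simp) h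
  clear hx
  induction huniv using Submodule.span_induction with
  | zero => exact ⟨0, zero_mem _⟩
  | smul c x _ h => exact h.imp fun r hr => Submodule.smul_mem _ c hr
  | add x y _ _ h h' =>
    obtain ⟨r, hr⟩ := h
    obtain ⟨r', hr'⟩ := h'
    exact ⟨max r r', add_mem (degSpan_mono (box_mono (le_max_left _ _)) hr)
      (degSpan_mono (box_mono (le_max_right _ _)) hr')⟩
  | mem x hx =>
    obtain ⟨a, v, v', l, m, -, rfl⟩ := hx
    obtain ⟨r, hr⟩ := exists_mem_box (G.degZ l - G.degZ m)
    exact ⟨r, Submodule.subset_span ⟨a, v, v', l, m, hr, rfl⟩⟩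

/-- On the `C⋆`-algebra generated by the direct sum of two families with gauge actions, both
coordinate projections are isometric. -/
theorem norm_fst_eq_norm_snd (ht : G.IsCKFamily hG t)
    (hne : ∀ v : Λ, t (𝟙 v) ≠ 0) (hgauge : G.HasGaugeAction t)
    (ht' : G.IsCKFamily hG t') (hne' : ∀ v : Λ, t' (𝟙 v) ≠ 0) (hgauge' : G.HasGaugeAction t')
    {x : A × B} (hx : x ∈ generated (pair t t')) : ‖x.1‖ = ‖x.2‖ := by
  have hclosed : IsClosed {x : A × B | ‖x.1‖ = ‖x.2‖} :=
    isClosed_eq continuous_fst.norm continuous_snd.norm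
  refine closure_minimal (fun y hy => ?_) hclosed hx
  obtain ⟨r, hr⟩ := (ht.isToeplitz.pair ht'.isToeplitz).exists_mem_degSpan_box hy
  exact norm_fst_eq_norm_snd_of_mem_box ht hne hgauge ht' hne' hgauge' hr

theorem dense_adjoin (t : ∀ {u v : Λ}, (u ⟶ v) → A) : Dense {y : generated t | (y : A) ∈
    NonUnitalStarAlgebra.adjoin ℂ {x : A | ∃ (a b : Λ) (l : a ⟶ b), x = t l}} := by
  intro y
  rw [closure_subtype]
  have hsub : (NonUnitalStarAlgebra.adjoin ℂ {x : A | ∃ (a b : Λ) (l : a ⟶ b), x = t l} : Set A) ⊆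
      (↑) '' {y : generated t | (y : A) ∈
        NonUnitalStarAlgebra.adjoin ℂ {x : A | ∃ (a b : Λ) (l : a ⟶ b), x = t l}} :=
    fun a ha => ⟨⟨a, NonUnitalStarSubalgebra.le_topologicalClosure _ ha⟩, ha, rfl⟩
  exact closure_mono hsub y.2

/-- An isometric homomorphism defined on `C⋆({t_λ})` that maps `t_λ` to `t'_λ` is an isomorphism
onto `C⋆({t'_λ})`. -/
theorem exists_starAlgEquiv_of_norm_eq (φ : generated t →⋆ₙₐ[ℂ] B) (hφ : ∀ x, ‖φ x‖ = ‖x‖)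
    (hgen : ∀ {a b : Λ} (l : a ⟶ b), φ (gen t l) = t' l) :
    ∃ ψ : generated t ≃⋆ₐ[ℂ] generated t', ∀ {a b : Λ} (l : a ⟶ b), ψ (gen t l) = gen t' l := by
  have hiso : Isometry φ := AddMonoidHomClass.isometry_of_norm φ hφ
  have hrange : IsClosed (Set.range φ) := hiso.isClosedEmbedding.isClosed_range
  have hadj : ∀ x ∈ NonUnitalStarAlgebra.adjoin ℂ {x : A | ∃ (a b : Λ) (l : a ⟶ b), x = t l},
      ∃ hx : x ∈ generated t, φ ⟨x, hx⟩ ∈ generated t' := by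
    intro x hx
    induction hx using NonUnitalStarAlgebra.adjoin_induction with
    | mem x hx =>
      obtain ⟨a, b, l, rfl⟩ := hx
      exact ⟨mem_generated t l, (hgen l).symm ▸ mem_generated t' l⟩
    | add x y _ _ h h' =>
      exact ⟨add_mem h.1 h'.1, by
        have := add_mem h.2 h'.2
        rwa [← map_add] at this⟩
    | zero => exact ⟨zero_mem _, by
        have := zero_mem (generated t')
        rwa [← map_zero φ] at this⟩
    | mul x y _ _ h h' =>
      exact ⟨mul_mem h.1 h'.1, by
        have := mul_mem h.2 h'.2
        rwa [← map_mul] at this⟩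
    | smul c x _ h =>
      exact ⟨SMulMemClass.smul_mem c h.1, by
        have := SMulMemClass.smul_mem c h.2
        rwa [← map_smul] at this⟩
    | star x _ h =>
      exact ⟨star_mem h.1, by
        have := star_mem h.2
        rwa [← map_star] at this⟩
  have hmaps : ∀ x, φ x ∈ generated t' := fun x =>
    closure_minimal (t := φ ⁻¹' (generated t' : Set B)) (fun y hy => (hadj y hy).2)
      ((isClosed_generated t').preimage hiso.continuous) (dense_adjoin t x)
  have hsurj : ∀ y ∈ generated t', ∃ x, φ x = y := by
    have hle : NonUnitalStarAlgebra.adjoin ℂ {x : B | ∃ (a b : Λ) (l : a ⟶ b), x = t' l} ≤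
        NonUnitalStarAlgHom.range φ := by
      refine NonUnitalStarAlgebra.adjoin_le ?_
      rintro _ ⟨a, b, l, rfl⟩
      exact ⟨gen t l, hgen l⟩
    exact fun y hy => closure_minimal (s := (NonUnitalStarAlgebra.adjoin ℂ
      {x : B | ∃ (a b : Λ) (l : a ⟶ b), x = t' l} : Set B)) hle hrange hy
  let ψ := NonUnitalStarAlgHom.codRestrict φ (generated t') hmaps
  have hψ : Function.Bijective ψ := by
    refine ⟨fun x y h => hiso.injective (congrArg Subtype.val h), fun y => ?_⟩
    obtain ⟨x, hx⟩ := hsurj y y.2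
    exact ⟨x, Subtype.ext hx⟩
  exact ⟨StarAlgEquiv.ofBijective ψ hψ, fun l => Subtype.ext (hgen l)⟩

/-- The gauge-invariant uniqueness theorem. -/
theorem exists_starAlgEquiv (ht : G.IsCKFamily hG t)
    (hne : ∀ v : Λ, t (𝟙 v) ≠ 0) (hgauge : G.HasGaugeAction t)
    (ht' : G.IsCKFamily hG t') (hne' : ∀ v : Λ, t' (𝟙 v) ≠ 0) (hgauge' : G.HasGaugeAction t') :
    ∃ φ : generated t ≃⋆ₐ[ℂ] generated t', ∀ {a b : Λ} (l : a ⟶ b), φ (gen t l) = gen t' l := by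
  let S := generated (pair t t')
  have hnorm : ∀ x : S, ‖(x : A × B).1‖ = ‖(x : A × B).2‖ := fun x =>
    norm_fst_eq_norm_snd ht hne hgauge ht' hne' hgauge' x.2
  -- The norm of `A × B` is the maximum of the coordinate norms, and these agree on `S`, so each
  -- projection is isometric.
  obtain ⟨φ, hφ⟩ := exists_starAlgEquiv_of_norm_eq (t' := t)
    ((NonUnitalStarAlgHom.fst ℂ A B).comp (NonUnitalStarSubalgebraClass.subtype S))
    (fun x => by
      change ‖(x : A × B).1‖ = max ‖(x : A × B).1‖ ‖(x : A × B).2‖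
      rw [← hnorm, max_self]) (fun l => rfl)
  obtain ⟨ψ, hψ⟩ := exists_starAlgEquiv_of_norm_eq (t' := t')
    ((NonUnitalStarAlgHom.snd ℂ A B).comp (NonUnitalStarSubalgebraClass.subtype S))
    (fun x => by
      change ‖(x : A × B).2‖ = max ‖(x : A × B).1‖ ‖(x : A × B).2‖
      rw [hnorm, max_self]) (fun l => rfl)
  refine ⟨φ.symm.trans ψ, fun l => ?_⟩
  rw [← hψ, ← hφ]
  simp

end Compare

/-! ### Maximal filters of paths. -/

/-- `x` is an initial segment of `z`. -/
def Pre {v : Λ} (x z : PathsTo v) : Prop := ∃ γ : z.1 ⟶ x.1, z.2 = γ ≫ x.2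

theorem Pre.refl {v : Λ} (x : PathsTo v) : Pre x x := ⟨𝟙 _, by simp⟩

theorem Pre.trans {v : Λ} {x y z : PathsTo v} (h : Pre x y) (h' : Pre y z) : Pre x z := by
  obtain ⟨γ, hγ⟩ := h
  obtain ⟨δ, hδ⟩ := h'
  exact ⟨δ ≫ γ, by rw [hδ, hγ, Category.assoc]⟩

/-- A nonempty directed set of paths with range `v` that is closed under initial segments. -/
structure IsPathFilter {v : Λ} (F : Set (PathsTo v)) : Prop where
  id_mem : (⟨v, 𝟙 v⟩ : PathsTo v) ∈ F
  down : ∀ x z : PathsTo v, Pre x z → z ∈ F → x ∈ F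
  directed : ∀ x ∈ F, ∀ y ∈ F, ∃ z ∈ F, Pre x z ∧ Pre y z

/-- A maximal path filter. -/
structure IsMaxFilter {v : Λ} (F : Set (PathsTo v)) : Prop extends IsPathFilter F where
  eq_of_subset : ∀ F', IsPathFilter F' → F ⊆ F' → F' = F

theorem exists_isMaxFilter (v : Λ) : ∃ F : Set (PathsTo v), IsMaxFilter F := by
  have hpt : IsPathFilter ({x | Pre x (⟨v, 𝟙 v⟩ : PathsTo v)} : Set (PathsTo v)) :=
    ⟨Pre.refl _, fun x z h h' => h.trans h', fun x hx y hy => ⟨_, Pre.refl _, hx, hy⟩⟩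
  obtain ⟨F, -, hF⟩ := zorn_subset_nonempty {F : Set (PathsTo v) | IsPathFilter F} (by
    intro c hc hchain hne
    refine ⟨⋃₀ c, ⟨?_, ?_, ?_⟩, fun s hs => Set.subset_sUnion_of_mem hs⟩
    · obtain ⟨F, hF⟩ := hne
      exact ⟨F, hF, (hc hF).id_mem⟩
    · rintro x z h ⟨F, hF, hz⟩
      exact ⟨F, hF, (hc hF).down x z h hz⟩
    · rintro x ⟨F, hF, hx⟩ y ⟨F', hF', hy⟩
      rcases hchain.total hF hF' with h | h
      · obtain ⟨z, hz, h1⟩ := (hc hF').directed x (h hx) y hy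
        exact ⟨z, ⟨F', hF', hz⟩, h1⟩
      · obtain ⟨z, hz, h1⟩ := (hc hF).directed x hx y (h hy)
        exact ⟨z, ⟨F, hF, hz⟩, h1⟩) _ hpt
  exact ⟨F, hF.1, fun F' hF' h => (hF.2 hF' h).antisymm h⟩

/-- A path outside a maximal filter has no common extension with some element of the filter. -/
theorem IsMaxFilter.exists_Lmin_empty {G : KGraph k Λ} (hG : G.FinitelyAligned) {v : Λ}
    {F : Set (PathsTo v)} (hF : IsMaxFilter F) {x : PathsTo v} (hx : x ∉ F) :
    ∃ y ∈ F, ¬ (G.Lmin x.2 y.2).Nonempty := by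
  by_contra! hcon
  let _ : Preorder F :=
    { le := fun y z => Pre y.1 z.1
      le_refl := fun y => Pre.refl _
      le_trans := fun _ _ _ => Pre.trans }
  have : Nonempty F := ⟨⟨_, hF.id_mem⟩⟩
  have : IsDirectedOrder F := ⟨fun y z => by
    obtain ⟨z', hz', h⟩ := hF.directed _ y.2 _ z.2
    exact ⟨⟨z', hz'⟩, h⟩⟩
  have hg : ∀ y : F, ∃ z : PathsTo v, Pre x z ∧ Pre y.1 z := by
    intro y
    obtain ⟨⟨c, α, β⟩, hp, -⟩ := hcon y.1 y.2
    exact ⟨⟨c, α ≫ x.2⟩, ⟨α, rfl⟩, ⟨β, hp⟩⟩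
  choose g hg1 hg2 using hg
  -- `g y` extends both `x` and `y`. The initial segments of `g y` for `U`-most `y` will form a
  -- filter containing `F` and `x`, so maximality puts `x` in `F`.
  let U : Ultrafilter F := Ultrafilter.of Filter.atTop
  have hU : (U : Filter F) ≤ Filter.atTop := Ultrafilter.of_le _
  set F' : Set (PathsTo v) := {ρ | ∀ᶠ y in (U : Filter F), Pre ρ (g y)} with hF'
  have hsub : F ⊆ F' := fun ρ hρ =>
    ((Filter.eventually_ge_atTop (⟨ρ, hρ⟩ : F)).filter_mono hU).mono fun y hy =>
      Pre.trans hy (hg2 y)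
  have hfil : IsPathFilter F' := by
    refine ⟨hsub hF.id_mem, fun a z h hz => hz.mono fun y hy => h.trans hy, ?_⟩
    intro a ha b hb
    have h1 : ∀ᶠ y in (U : Filter F), ∃ p ∈ G.Lmin a.2 b.2, Pre ⟨p.1, p.2.1 ≫ a.2⟩ (g y) := by
      filter_upwards [ha, hb] with y hay hby
      obtain ⟨e, he⟩ := hay
      obtain ⟨e', he'⟩ := hby
      obtain ⟨p, hp, ε, h1, -⟩ := G.exists_mem_Lmin (he.symm.trans he')
      exact ⟨p, hp, ε, by rw [he, h1, Category.assoc]⟩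
    -- Finite alignment enters here: among finitely many minimal extensions, the ultrafilter selects
    -- one that works for `U`-most `y`.
    rw [Ultrafilter.eventually_exists_mem_iff (hG a.2 b.2)] at h1
    obtain ⟨p, hp, h1⟩ := h1
    exact ⟨_, h1, ⟨p.2.1, rfl⟩, ⟨p.2.2, hp.1⟩⟩
  refine hx ?_
  rw [← hF.eq_of_subset F' hfil hsub]
  exact Filter.Eventually.of_forall hg1

/-- A maximal filter meets every finite exhaustive set. -/
theorem IsMaxFilter.exists_mem_of_isExhaustive {G : KGraph k Λ} (hG : G.FinitelyAligned) {v : Λ}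
    {F : Set (PathsTo v)} (hF : IsMaxFilter F) (E : List (PathsTo v))
    (hE : G.IsExhaustive {l | l ∈ E}) : ∃ l ∈ E, l ∈ F := by
  by_contra! hcon
  -- Directedness merges the finitely many witnesses of non-membership into one path of `F` that has
  -- no common extension with any member of `L`.
  have key : ∀ L : List (PathsTo v), (∀ l ∈ L, l ∉ F) →
      ∃ y ∈ F, ∀ l ∈ L, ¬ (G.Lmin l.2 y.2).Nonempty := by
    intro L
    induction L with
    | nil => exact fun _ => ⟨_, hF.id_mem, by simp⟩
    | cons l L ih =>
      intro hL
      obtain ⟨y, hy, h1⟩ := ih fun m hm => hL m (List.mem_cons_of_mem _ hm)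
      obtain ⟨y', hy', h2⟩ := hF.exists_Lmin_empty hG (hL l List.mem_cons_self)
      obtain ⟨z, hz, ⟨γ, hγ⟩, ⟨γ', hγ'⟩⟩ := hF.directed y hy y' hy'
      refine ⟨z, hz, fun m hm hne => ?_⟩
      obtain ⟨c, e, e', h⟩ := G.Lmin_nonempty_iff.1 hne
      rcases List.mem_cons.1 hm with rfl | hm
      · exact h2 (G.Lmin_nonempty_iff.2 ⟨c, e, e' ≫ γ', by rw [h, hγ', Category.assoc]⟩)
      · exact h1 m hm (G.Lmin_nonempty_iff.2 ⟨c, e, e' ≫ γ, by rw [h, hγ, Category.assoc]⟩)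
  obtain ⟨y, -, h1⟩ := key E hcon
  obtain ⟨l, hl, h2⟩ := hE y
  exact h1 l hl h2

/-! ### Prefixing and removing a path on filters. -/

section Shift

/-- The paths `γ` with `l γ ∈ F`. -/
def tail {a v : Λ} (l : a ⟶ v) (F : Set (PathsTo v)) : Set (PathsTo a) :=
  {x | (⟨x.1, x.2 ≫ l⟩ : PathsTo v) ∈ F}

/-- The initial segments of the paths `l γ` with `γ ∈ F`. -/
def cons {a v : Λ} (l : a ⟶ v) (F : Set (PathsTo a)) : Set (PathsTo v) :=
  {x | ∃ y ∈ F, Pre x ⟨y.1, y.2 ≫ l⟩}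

theorem tail_mono {a v : Λ} (l : a ⟶ v) {F F' : Set (PathsTo v)} (h : F ⊆ F') :
    tail l F ⊆ tail l F' := fun _ hx => h hx

theorem cons_mono {a v : Λ} (l : a ⟶ v) {F F' : Set (PathsTo a)} (h : F ⊆ F') :
    cons l F ⊆ cons l F' := fun _ ⟨y, hy, hxy⟩ => ⟨y, h hy, hxy⟩

theorem mem_cons {a v : Λ} (l : a ⟶ v) {F : Set (PathsTo a)} (hF : IsPathFilter F) :
    (⟨a, l⟩ : PathsTo v) ∈ cons l F := ⟨_, hF.id_mem, 𝟙 a, rfl⟩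

theorem isPathFilter_cons {a v : Λ} (l : a ⟶ v) {F : Set (PathsTo a)} (hF : IsPathFilter F) :
    IsPathFilter (cons l F) where
  id_mem := ⟨_, hF.id_mem, l, by simp⟩
  down := fun x z h ⟨y, hy, hz⟩ => ⟨y, hy, h.trans hz⟩
  directed := by
    rintro x ⟨x', hx', hx⟩ y ⟨y', hy', hy⟩
    obtain ⟨z, hz, ⟨γ, hγ⟩, ⟨δ, hδ⟩⟩ := hF.directed x' hx' y' hy'
    exact ⟨⟨z.1, z.2 ≫ l⟩, ⟨z, hz, Pre.refl _⟩, hx.trans ⟨γ, by simp [hγ]⟩,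
      hy.trans ⟨δ, by simp [hδ]⟩⟩

theorem isPathFilter_tail (G : KGraph k Λ) {a v : Λ} {l : a ⟶ v} {F : Set (PathsTo v)}
    (hF : IsPathFilter F) (hl : (⟨a, l⟩ : PathsTo v) ∈ F) : IsPathFilter (tail l F) where
  id_mem := by simpa [tail] using hl
  down := fun x z ⟨γ, hγ⟩ hz => hF.down _ _ ⟨γ, by simp [hγ]⟩ hz
  directed := by
    intro x hx y hy
    obtain ⟨⟨c, z⟩, hz, ⟨γ, hγ⟩, ⟨δ, hδ⟩⟩ := hF.directed _ hx _ hy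
    dsimp only at γ δ hγ hδ
    subst hγ
    rw [← Category.assoc, ← Category.assoc] at hδ
    exact ⟨⟨c, γ ≫ x.2⟩, by simpa [tail] using hz, ⟨γ, rfl⟩, ⟨δ, G.comp_right_cancel hδ⟩⟩

theorem tail_cons (G : KGraph k Λ) {a v : Λ} (l : a ⟶ v) {F : Set (PathsTo a)}
    (hF : IsPathFilter F) : tail l (cons l F) = F := by
  ext x
  constructor
  · rintro ⟨y, hy, γ, hγ⟩
    dsimp only at γ hγ
    rw [← Category.assoc] at hγ
    exact hF.down x y ⟨γ, G.comp_right_cancel hγ⟩ hy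
  · exact fun hx => ⟨x, hx, Pre.refl _⟩

theorem cons_tail {a v : Λ} {l : a ⟶ v} {F : Set (PathsTo v)}
    (hF : IsPathFilter F) (hl : (⟨a, l⟩ : PathsTo v) ∈ F) : cons l (tail l F) = F := by
  ext x
  constructor
  · rintro ⟨y, hy, h⟩
    exact hF.down _ _ h hy
  · intro hx
    obtain ⟨⟨c, z⟩, hz, h, ⟨γ, hγ⟩⟩ := hF.directed _ hx _ hl
    dsimp only at γ hγ
    subst hγ
    exact ⟨⟨c, γ⟩, hz, h⟩

/-- `cons l` and `tail l` are mutually inverse monotone maps between the filters at `a` and the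
filters at `v` containing `l`, so they preserve maximality. -/
theorem isMaxFilter_cons (G : KGraph k Λ) {a v : Λ} (l : a ⟶ v) {F : Set (PathsTo a)}
    (hF : IsMaxFilter F) : IsMaxFilter (cons l F) := by
  refine ⟨isPathFilter_cons l hF.toIsPathFilter, fun F' hF' hsub => ?_⟩
  have hl := hsub (mem_cons l hF.toIsPathFilter)
  have h1 : F ⊆ tail l F' := by
    have := tail_mono l hsub
    rwa [tail_cons G l hF.toIsPathFilter] at this
  rw [← hF.eq_of_subset _ (isPathFilter_tail G hF' hl) h1, cons_tail hF' hl]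

theorem isMaxFilter_tail (G : KGraph k Λ) {a v : Λ} {l : a ⟶ v} {F : Set (PathsTo v)}
    (hF : IsMaxFilter F) (hl : (⟨a, l⟩ : PathsTo v) ∈ F) : IsMaxFilter (tail l F) := by
  refine ⟨isPathFilter_tail G hF.toIsPathFilter hl, fun F' hF' hsub => ?_⟩
  have h1 : F ⊆ cons l F' := by
    have := cons_mono l hsub
    rwa [cons_tail hF.toIsPathFilter hl] at this
  rw [← hF.eq_of_subset _ (isPathFilter_cons l hF') h1, tail_cons G l hF']

theorem cons_comp {a b v : Λ} (l : a ⟶ v) (m : b ⟶ a) (F : Set (PathsTo b)) :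
    cons (m ≫ l) F = cons l (cons m F) := by
  ext x
  constructor
  · rintro ⟨y, hy, h⟩
    exact ⟨⟨y.1, y.2 ≫ m⟩, ⟨y, hy, Pre.refl _⟩, by simpa using h⟩
  · rintro ⟨z, ⟨y, hy, ⟨γ, hγ⟩⟩, h⟩
    refine ⟨y, hy, h.trans ⟨γ, ?_⟩⟩
    dsimp only at γ hγ ⊢
    rw [← Category.assoc, hγ, Category.assoc]

theorem cons_id {v : Λ} {F : Set (PathsTo v)} (hF : IsPathFilter F) : cons (𝟙 v) F = F := by
  ext x
  constructor
  · rintro ⟨y, hy, h⟩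
    exact hF.down _ y (by simpa using h) hy
  · exact fun hx => ⟨x, hx, by simpa using Pre.refl x⟩

end Shift

end KGraph

/-! ### Partial injections as partial isometries of `ℓ²`. -/

/-- A partial injection, as a relation. -/
structure PInj (Y : Type*) where
  rel : Y → Y → Prop
  functional : ∀ {z y y'}, rel z y → rel z y' → y = y'
  injective : ∀ {z z' y}, rel z y → rel z' y → z = z'

namespace PInj

variable {Y : Type*}

/-- The inverse partial injection. -/
def symm (r : PInj Y) : PInj Y := ⟨fun z y => r.rel y z, r.injective, r.functional⟩

/-- The composition of two partial injections, `s` being applied first. -/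
def comp (r s : PInj Y) : PInj Y where
  rel z y := ∃ w, s.rel z w ∧ r.rel w y
  functional := by
    rintro z y y' ⟨w, h1, h2⟩ ⟨w', h3, h4⟩
    cases s.functional h1 h3
    exact r.functional h2 h4
  injective := by
    rintro z z' y ⟨w, h1, h2⟩ ⟨w', h3, h4⟩
    cases r.injective h2 h4
    exact s.injective h1 h3

/-- The Hilbert space `ℓ²(Y)`. -/
noncomputable abbrev L2 (Y : Type*) := lp (fun _ : Y => ℂ) 2

open Classical in
/-- The function `y ↦ x (r⁻¹ y)`, extended by zero. -/
noncomputable def pull (r : PInj Y) (x : Y → ℂ) (y : Y) : ℂ :=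
  if h : ∃ z, r.rel z y then x h.choose else 0

theorem pull_of_rel (r : PInj Y) (x : Y → ℂ) {z y : Y} (h : r.rel z y) : r.pull x y = x z := by
  have h' : ∃ z, r.rel z y := ⟨z, h⟩
  rw [pull, dif_pos h', r.injective h'.choose_spec h]

theorem pull_of_not (r : PInj Y) (x : Y → ℂ) {y : Y} (h : ¬ ∃ z, r.rel z y) :
    r.pull x y = 0 := by
  rw [pull, dif_neg h]

/-- Because the relation is functional, choosing preimages is injective on the range of `r`, so each
value of `x` is counted at most once. The default value of `g` off the range plays no role. -/
theorem sum_pull_le (r : PInj Y) (x : L2 Y) (s : Finset Y) :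
    ∑ y ∈ s, ‖r.pull x y‖ ^ (2 : ENNReal).toReal ≤ ‖x‖ ^ (2 : ENNReal).toReal := by
  classical
  have h2 : 0 < (2 : ENNReal).toReal := by norm_num
  let g : Y → Y := fun y => if h : ∃ z, r.rel z y then h.choose else y
  have hg : ∀ y, (∃ z, r.rel z y) → r.rel (g y) y := by
    intro y h
    simp only [g, dif_pos h]
    exact h.choose_spec
  calc _ = ∑ y ∈ s with ∃ z, r.rel z y, ‖r.pull x y‖ ^ (2 : ENNReal).toReal := by
        rw [Finset.sum_filter]
        refine Finset.sum_congr rfl fun y _ => ?_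
        split_ifs with h
        · rfl
        · rw [r.pull_of_not _ h, norm_zero, Real.zero_rpow h2.ne']
    _ = ∑ y ∈ s with ∃ z, r.rel z y, ‖x (g y)‖ ^ (2 : ENNReal).toReal := by
        refine Finset.sum_congr rfl fun y hy => ?_
        rw [r.pull_of_rel _ (hg y (Finset.mem_filter.1 hy).2)]
    _ = ∑ z ∈ (s.filter fun y => ∃ z, r.rel z y).image g, ‖x z‖ ^ (2 : ENNReal).toReal := by
        rw [Finset.sum_image]
        intro y hy y' hy' h
        have h1 := hg y (Finset.mem_filter.1 hy).2
        have h2 := hg y' (Finset.mem_filter.1 hy').2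
        rw [h] at h1
        exact r.functional h1 h2
    _ ≤ _ := lp.sum_rpow_le_norm_rpow h2 x _

/-- The operator on `ℓ²(Y)` that maps the basis vector at `z` to the one at `y` if `z` and `y` are
related, and to zero if `z` is outside the domain. -/
noncomputable def op (r : PInj Y) : L2 Y →L[ℂ] L2 Y :=
  LinearMap.mkContinuous
    { toFun := fun x => ⟨r.pull x, memℓp_gen' (r.sum_pull_le x)⟩
      map_add' := by
        intro x x'
        refine lp.ext (funext fun y => ?_)
        change r.pull (x + x') y = r.pull x y + r.pull x' y
        by_cases h : ∃ z, r.rel z y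
        · obtain ⟨z, hz⟩ := h
          simp only [r.pull_of_rel _ hz]
          rfl
        · simp [r.pull_of_not _ h]
      map_smul' := by
        intro c x
        refine lp.ext (funext fun y => ?_)
        change r.pull (c • x) y = c • r.pull x y
        by_cases h : ∃ z, r.rel z y
        · obtain ⟨z, hz⟩ := h
          simp only [r.pull_of_rel _ hz]
          rfl
        · simp [r.pull_of_not _ h] } 1
    (fun x => by
      rw [one_mul]
      exact lp.norm_le_of_forall_sum_le (by norm_num) (norm_nonneg _) (r.sum_pull_le x))

theorem op_apply_of_rel (r : PInj Y) (x : L2 Y) {z y : Y} (h : r.rel z y) : r.op x y = x z :=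
  r.pull_of_rel _ h

theorem op_apply_of_not (r : PInj Y) (x : L2 Y) {y : Y} (h : ¬ ∃ z, r.rel z y) :
    r.op x y = 0 :=
  r.pull_of_not _ h

theorem ext_op {S T : L2 Y →L[ℂ] L2 Y} (h : ∀ x y, S x y = T x y) : S = T :=
  ContinuousLinearMap.ext fun x => lp.ext (funext (h x))

theorem op_congr {r s : PInj Y} (h : ∀ z y, r.rel z y ↔ s.rel z y) : r.op = s.op := by
  refine ext_op fun x y => ?_
  by_cases hy : ∃ z, r.rel z y
  · obtain ⟨z, hz⟩ := hy
    rw [r.op_apply_of_rel x hz, s.op_apply_of_rel x ((h z y).1 hz)]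
  · rw [r.op_apply_of_not x hy, s.op_apply_of_not x fun ⟨z, hz⟩ => hy ⟨z, (h z y).2 hz⟩]

theorem op_mul_op (r s : PInj Y) : r.op * s.op = (r.comp s).op := by
  refine ext_op fun x y => ?_
  change r.op (s.op x) y = _
  by_cases h : ∃ w, r.rel w y
  · obtain ⟨w, hw⟩ := h
    rw [r.op_apply_of_rel _ hw]
    by_cases h' : ∃ z, s.rel z w
    · obtain ⟨z, hz⟩ := h'
      rw [s.op_apply_of_rel _ hz, (r.comp s).op_apply_of_rel x ⟨w, hz, hw⟩]
    · rw [s.op_apply_of_not _ h', (r.comp s).op_apply_of_not]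
      rintro ⟨z, w', h1, h2⟩
      cases r.injective hw h2
      exact h' ⟨z, h1⟩
  · rw [r.op_apply_of_not _ h, (r.comp s).op_apply_of_not]
    rintro ⟨z, w, -, h2⟩
    exact h ⟨w, h2⟩

/-- Both inner products are sums over the graph of `r`, indexed once by its sources and once by its
targets. -/
theorem star_op (r : PInj Y) : star r.op = r.symm.op := by
  symm
  rw [ContinuousLinearMap.star_eq_adjoint, ContinuousLinearMap.eq_adjoint_iff]
  intro x y
  rw [lp.inner_eq_tsum, lp.inner_eq_tsum]
  symm
  have hsupp : ∀ z : Function.support fun z => inner ℂ (r.symm.op x z) (y z),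
      ∃ w, r.rel z w := by
    rintro ⟨z, hz⟩
    by_contra h
    refine hz ?_
    dsimp only
    rw [r.symm.op_apply_of_not x h, inner_zero_left]
  choose i hi using hsupp
  refine tsum_eq_tsum_of_ne_zero_bij i ?_ ?_ ?_
  · intro z z' h
    have h1 := hi z
    rw [h] at h1
    exact Subtype.ext (r.injective h1 (hi z'))
  · intro w hw
    by_cases h : ∃ z, r.rel z w
    · obtain ⟨z, hz⟩ := h
      have hz' : z ∈ Function.support fun z => inner ℂ (r.symm.op x z) (y z) := by
        rw [Function.mem_support] at hw ⊢
        rwa [r.symm.op_apply_of_rel x (show r.symm.rel w z from hz),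
          ← r.op_apply_of_rel y hz]
      exact ⟨⟨z, hz'⟩, r.functional (hi ⟨z, hz'⟩) hz⟩
    · refine absurd ?_ hw
      dsimp only
      rw [r.op_apply_of_not y h, inner_zero_right]
  · intro z
    rw [r.symm.op_apply_of_rel x (show r.symm.rel (i z) z from hi z), r.op_apply_of_rel y (hi z)]

/-- The operator of a disjoint union of partial injections. -/
theorem op_eq_sum {ι : Type*} (r : PInj Y) (f : ι → PInj Y) (s : Finset ι)
    (h : ∀ z y, r.rel z y ↔ ∃ i ∈ s, (f i).rel z y)
    (hdisj : ∀ i ∈ s, ∀ j ∈ s, ∀ z z' y, (f i).rel z y → (f j).rel z' y → i = j) :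
    r.op = ∑ i ∈ s, (f i).op := by
  refine ext_op fun x y => ?_
  have hsum : (∑ i ∈ s, (f i).op) x y = ∑ i ∈ s, (f i).op x y := by
    rw [sum_apply, lp.coeFn_sum, Finset.sum_apply]
  rw [hsum]
  by_cases hy : ∃ z, r.rel z y
  · obtain ⟨z, hz⟩ := hy
    obtain ⟨i, hi, hiz⟩ := (h z y).1 hz
    rw [r.op_apply_of_rel x hz, Finset.sum_eq_single_of_mem i hi, (f i).op_apply_of_rel x hiz]
    intro j hj hji
    refine (f j).op_apply_of_not x ?_
    rintro ⟨z', hz'⟩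
    exact hji (hdisj j hj i hi z' z y hz' hiz)
  · rw [r.op_apply_of_not x hy, Finset.sum_eq_zero]
    intro i hi
    refine (f i).op_apply_of_not x ?_
    rintro ⟨z, hz⟩
    exact hy ⟨z, (h z y).2 ⟨i, hi, hz⟩⟩

theorem op_ne_zero {r : PInj Y} {z y : Y} (h : r.rel z y) : r.op ≠ 0 := by
  classical
  intro h0
  have h1 := r.op_apply_of_rel (lp.single 2 z (1 : ℂ)) h
  rw [h0, lp.single_apply_self] at h1
  exact zero_ne_one h1

theorem op_eq_zero {r : PInj Y} (h : ∀ z y, ¬ r.rel z y) : r.op = 0 :=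
  ext_op fun x y => r.op_apply_of_not x fun ⟨z, hz⟩ => h z y hz

/-- Pointwise multiplication by a function with values in the circle. -/
noncomputable def diag (c : Y → Circle) : L2 Y →ₗᵢ[ℂ] L2 Y where
  toFun x := ⟨fun y => (c y : ℂ) * x y, (lp.memℓp x).mono' fun i => by
    rw [norm_mul, Circle.norm_coe, one_mul]⟩
  map_add' x x' := lp.ext (funext fun y => mul_add _ _ _)
  map_smul' a x := lp.ext (funext fun y => mul_left_comm _ _ _)
  norm_map' x := 
    have h : ∀ i, ‖(c i : ℂ) * x i‖ = ‖x i‖ := fun i => by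
      rw [norm_mul, Circle.norm_coe, one_mul]
    le_antisymm (lp.norm_mono (by norm_num) fun i => (h i).le)
      (lp.norm_mono (by norm_num) fun i => (h i).ge)

theorem diag_apply (c : Y → Circle) (x : L2 Y) (y : Y) : diag c x y = c y * x y := rfl

theorem diag_mul_apply (c c' : Y → Circle) (x : L2 Y) : diag (c * c') x = diag c (diag c' x) :=
  lp.ext (funext fun y => by simp [diag_apply, mul_assoc])

theorem diag_one_apply (x : L2 Y) : diag 1 x = x :=
  lp.ext (funext fun y => by simp [diag_apply])

/-- Pointwise multiplication by a function with values in the circle, as a unitary operator. -/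
noncomputable def diagUnitary : (Y → Circle) →* unitary (L2 Y →L[ℂ] L2 Y) where
  toFun c := Unitary.linearIsometryEquiv.symm
    { diag c with
      invFun := diag c⁻¹
      left_inv := fun x => by
        change diag c⁻¹ (diag c x) = x
        rw [← diag_mul_apply, inv_mul_cancel, diag_one_apply]
      right_inv := fun x => by
        change diag c (diag c⁻¹ x) = x
        rw [← diag_mul_apply, mul_inv_cancel, diag_one_apply] }
  map_one' := Subtype.ext (ContinuousLinearMap.ext diag_one_apply)
  map_mul' c c' := Subtype.ext (ContinuousLinearMap.ext (diag_mul_apply c c'))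

theorem diagUnitary_apply (c : Y → Circle) (x : L2 Y) (y : Y) :
    (diagUnitary c : L2 Y →L[ℂ] L2 Y) x y = c y * x y := rfl

theorem conj_op (r : PInj Y) (c : Y → Circle) (a : ℂ)
    (h : ∀ z y, r.rel z y → (c y : ℂ) = a * c z) :
    Unitary.conjStarAlgAut ℂ (L2 Y →L[ℂ] L2 Y) (diagUnitary c) r.op = a • r.op := by
  have h1 : (diagUnitary c : L2 Y →L[ℂ] L2 Y) * r.op =
      a • (r.op * (diagUnitary c : L2 Y →L[ℂ] L2 Y)) := by
    refine ext_op fun x y => ?_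
    change (diagUnitary c : L2 Y →L[ℂ] L2 Y) (r.op x) y =
      a * r.op ((diagUnitary c : L2 Y →L[ℂ] L2 Y) x) y
    rw [diagUnitary_apply]
    by_cases hy : ∃ z, r.rel z y
    · obtain ⟨z, hz⟩ := hy
      rw [r.op_apply_of_rel _ hz, r.op_apply_of_rel _ hz, diagUnitary_apply, h z y hz, mul_assoc]
    · rw [r.op_apply_of_not _ hy, r.op_apply_of_not _ hy, mul_zero, mul_zero]
  rw [Unitary.conjStarAlgAut_apply, h1, smul_mul_assoc, mul_assoc,
    Unitary.mul_star_self_of_mem (diagUnitary c).2, mul_one]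

end PInj

/-! ### The boundary representation and its gauge action. -/

namespace KGraph

variable {k : ℕ} {Λ : Type u} [Category.{w} Λ]

section GaugeConstruction

variable {G : KGraph k Λ} {A : Type*} [NonUnitalCStarAlgebra A] {t : ∀ {u v : Λ}, (u ⟶ v) → A}

/-- Automorphisms of the ambient algebra that multiply `t_λ` by `z ^ d(λ)` restrict to a gauge
action. -/
theorem hasGaugeAction_of_ambient (Φ : (Fin k → Circle) →* (A ≃⋆ₐ[ℂ] A))
    (hΦ : ∀ (z : Fin k → Circle) {a b : Λ} (l : a ⟶ b),
      Φ z (t l) = (∏ i, (z i : ℂ) ^ G.d l i) • t l) : G.HasGaugeAction t := by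
  have hcont : ∀ z, Continuous (Φ z) := fun z =>
    (NonUnitalStarAlgHom.isometry (Φ z) (Φ z).injective).continuous
  have hmaps : ∀ z, ∀ x : generated t, Φ z x ∈ generated t := by
    intro z x
    have hle : NonUnitalStarAlgebra.adjoin ℂ {x : A | ∃ (a b : Λ) (l : a ⟶ b), x = t l} ≤
        (generated t).comap (Φ z) := by
      refine NonUnitalStarAlgebra.adjoin_le ?_
      rintro _ ⟨a, b, l, rfl⟩
      change Φ z (t l) ∈ generated t
      rw [hΦ]
      exact SMulMemClass.smul_mem _ (mem_generated t l)
    exact closure_minimal (s := (NonUnitalStarAlgebra.adjoin ℂ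
      {x : A | ∃ (a b : Λ) (l : a ⟶ b), x = t l} : Set A)) hle
      ((isClosed_generated t).preimage (hcont z)) x.2
  let ρ : (Fin k → Circle) → generated t →⋆ₙₐ[ℂ] generated t := fun z =>
    NonUnitalStarAlgHom.codRestrict ((Φ z : A →⋆ₙₐ[ℂ] A).comp
      (NonUnitalStarSubalgebraClass.subtype (generated t))) (generated t) (hmaps z)
  have hρ : ∀ z (x : generated t), (ρ z x : A) = Φ z x := fun z x => rfl
  have hbij : ∀ z, Function.Bijective (ρ z) := by
    intro z
    refine ⟨fun x y h => Subtype.ext ((Φ z).injective (congrArg Subtype.val h)), fun y => ?_⟩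
    refine ⟨⟨Φ z⁻¹ y, hmaps _ y⟩, Subtype.ext ?_⟩
    rw [hρ]
    change (Φ z * Φ z⁻¹) (y : A) = y
    rw [← map_mul, mul_inv_cancel, map_one]
    rfl
  let θ : (Fin k → Circle) →* (generated t ≃⋆ₐ[ℂ] generated t) :=
    { toFun := fun z => StarAlgEquiv.ofBijective (ρ z) (hbij z)
      map_one' := by
        ext x
        change Φ 1 (x : A) = x
        rw [map_one]
        rfl
      map_mul' := by
        intro z z'
        ext x
        change Φ (z * z') (x : A) = Φ z (Φ z' x)
        rw [map_mul]
        rfl }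
  have hθ : ∀ z (x : generated t), (θ z x : A) = Φ z x := fun z x => rfl
  refine ⟨θ, fun x => ?_, fun z a b l => Subtype.ext (hΦ z l)⟩
  refine continuous_induced_rng.2 ?_
  change Continuous fun z => Φ z (x : A)
  have hadj : ∀ x ∈ NonUnitalStarAlgebra.adjoin ℂ {x : A | ∃ (a b : Λ) (l : a ⟶ b), x = t l},
      Continuous fun z => Φ z x := by
    intro x hx
    induction hx using NonUnitalStarAlgebra.adjoin_induction with
    | mem x hx =>
      obtain ⟨a, b, l, rfl⟩ := hx
      simp only [hΦ]
      fun_prop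
    | add x y _ _ h h' => simp only [map_add]; exact h.add h'
    | zero => simpa only [map_zero] using continuous_const
    | mul x y _ _ h h' => simp only [map_mul]; exact h.mul h'
    | smul c x _ h => simp only [map_smul]; exact h.const_smul c
    | star x _ h => simpa only [map_star] using h.star
  -- Each `Φ z` is isometric, so approximating `x` by an element of the `⋆`-algebra approximates its
  -- orbit map uniformly in `z`.
  refine continuous_of_uniform_approx_of_continuous fun U hU => ?_
  obtain ⟨ε, hε, hεU⟩ := Metric.mem_uniformity_dist.1 hU
  obtain ⟨y, hy, hxy⟩ := Metric.mem_closure_iff.1 (show (x : A) ∈ closure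
    (NonUnitalStarAlgebra.adjoin ℂ {x : A | ∃ (a b : Λ) (l : a ⟶ b), x = t l} : Set A) from x.2)
    ε hε
  refine ⟨fun z => Φ z y, hadj y hy, fun z => hεU ?_⟩
  rwa [(NonUnitalStarAlgHom.isometry (Φ z) (Φ z).injective).dist_eq]

end GaugeConstruction

section Boundary

/-- The maximal filters of paths, each together with its range. -/
abbrev Bdry (Λ : Type u) [Category.{w} Λ] : Type (max u w) :=
  Σ v : Λ, {F : Set (PathsTo v) // IsMaxFilter F}

variable (G : KGraph k Λ)

/-- The partial injection that prefixes maximal filters with a path, and adds its degree to a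
grading in `ℤ ^ k`. -/
def shift {a v : Λ} (l : a ⟶ v) : PInj (Bdry Λ × (Fin k → ℤ)) where
  rel z y := ∃ (F : Set (PathsTo a)) (hF : IsMaxFilter F) (n : Fin k → ℤ),
    z = (⟨a, F, hF⟩, n) ∧ y = (⟨v, cons l F, isMaxFilter_cons G l hF⟩, n + G.degZ l)
  functional := by
    rintro z y y' ⟨F, hF, n, rfl, rfl⟩ ⟨F', hF', n', h, rfl⟩
    cases h
    rfl
  injective := by
    rintro z z' y ⟨F, hF, n, rfl, rfl⟩ ⟨F', hF', n', rfl, h⟩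
    simp only [Prod.mk.injEq, Sigma.mk.injEq, heq_eq_eq, true_and, Subtype.mk.injEq,
      add_left_inj] at h
    obtain ⟨h1, rfl⟩ := h
    have := congrArg (tail l) h1
    rw [tail_cons G l hF.toIsPathFilter, tail_cons G l hF'.toIsPathFilter] at this
    subst this
    rfl

variable {G}

theorem shift_rel_mk {a v : Λ} (l : a ⟶ v) {F : Set (PathsTo a)} (hF : IsMaxFilter F)
    (n : Fin k → ℤ) : (G.shift l).rel (⟨a, F, hF⟩, n)
      (⟨v, cons l F, isMaxFilter_cons G l hF⟩, n + G.degZ l) := ⟨F, hF, n, rfl, rfl⟩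

theorem degZ_id (v : Λ) : G.degZ (𝟙 v) = 0 := by
  ext i
  simp [degZ, G.d_id]

theorem shift_id_rel_iff {v : Λ} {z y : Bdry Λ × (Fin k → ℤ)} :
    (G.shift (𝟙 v)).rel z y ↔ z = y ∧ y.1.1 = v := by
  constructor
  · rintro ⟨F, hF, n, rfl, rfl⟩
    simp [cons_id hF.toIsPathFilter, degZ_id]
  · rintro ⟨rfl, rfl⟩
    obtain ⟨⟨v, F, hF⟩, n⟩ := z
    exact ⟨F, hF, n, rfl, by simp [cons_id hF.toIsPathFilter, degZ_id]⟩

theorem shift_comp_rel_iff {a b c : Λ} (l : b ⟶ c) (m : a ⟶ b) (z y : Bdry Λ × (Fin k → ℤ)) :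
    ((G.shift l).comp (G.shift m)).rel z y ↔ (G.shift (m ≫ l)).rel z y := by
  constructor
  · rintro ⟨_, ⟨F, hF, n, rfl, rfl⟩, ⟨F', hF', n', h, rfl⟩⟩
    cases h
    exact ⟨F, hF, n, rfl, by simp [cons_comp, degZ_comp, add_comm, add_left_comm]⟩
  · rintro ⟨F, hF, n, rfl, rfl⟩
    refine ⟨_, shift_rel_mk m hF n, ?_⟩
    refine ⟨_, isMaxFilter_cons G m hF, _, rfl, ?_⟩
    simp [cons_comp, degZ_comp, add_comm, add_left_comm]

theorem shift_range_rel_iff {a v : Λ} (l : a ⟶ v) (z y : Bdry Λ × (Fin k → ℤ)) :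
    ((G.shift l).comp (G.shift l).symm).rel z y ↔
      z = y ∧ ∃ (F : Set (PathsTo v)) (hF : IsMaxFilter F), (⟨a, l⟩ : PathsTo v) ∈ F ∧
        y.1 = ⟨v, F, hF⟩ := by
  constructor
  · rintro ⟨w', h1, h2⟩
    have hzy : z = y := (G.shift l).functional h1 h2
    obtain ⟨F, hF, n, rfl, rfl⟩ := h2
    exact ⟨hzy, _, isMaxFilter_cons G l hF, mem_cons l hF.toIsPathFilter, rfl⟩
  · rintro ⟨rfl, F, hF, hl, h⟩
    obtain ⟨y, n⟩ := z
    dsimp only at h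
    subst h
    have h1 : (G.shift l).rel (⟨a, tail l F, isMaxFilter_tail G hF hl⟩, n - G.degZ l)
        (⟨v, F, hF⟩, n) :=
      ⟨_, isMaxFilter_tail G hF hl, _, rfl, by simp [cons_tail hF.toIsPathFilter hl]⟩
    exact ⟨_, h1, h1⟩

theorem exists_tail_rel {a v : Λ} {l : a ⟶ v} {F : Set (PathsTo v)} (hF : IsMaxFilter F)
    (hl : (⟨a, l⟩ : PathsTo v) ∈ F) (n : Fin k → ℤ) :
    (G.shift l).rel (⟨a, tail l F, isMaxFilter_tail G hF hl⟩, n - G.degZ l) (⟨v, F, hF⟩, n) :=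
  ⟨_, isMaxFilter_tail G hF hl, _, rfl, by simp [cons_tail hF.toIsPathFilter hl]⟩

theorem shift_rel_of_comp {a b c : Λ} {l : b ⟶ c} {m : a ⟶ b}
    {z y q : Bdry Λ × (Fin k → ℤ)} (h : (G.shift (m ≫ l)).rel z q) (h' : (G.shift l).rel y q) :
    (G.shift m).rel z y := by
  obtain ⟨y', h1, h2⟩ := (shift_comp_rel_iff l m z q).2 h
  rwa [(G.shift l).injective h' h2]

/-- A filter containing `l` and `m` contains a common extension, by directedness, and hence a
minimal one, by closure under initial segments. -/
theorem shift_star_mul_rel_iff {a b v : Λ} (l : a ⟶ v) (m : b ⟶ v)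
    (z y : Bdry Λ × (Fin k → ℤ)) :
    ((G.shift l).symm.comp (G.shift m)).rel z y ↔
      ∃ p ∈ G.Lmin l m, ((G.shift p.2.1).comp (G.shift p.2.2).symm).rel z y := by
  constructor
  · rintro ⟨⟨⟨v', C, hC⟩, n⟩, h1 : (G.shift m).rel _ _, h2 : (G.shift l).rel _ _⟩
    have hv : v' = v := by
      obtain ⟨F, hF, n, -, h⟩ := h1
      exact congrArg (fun q => q.1.1) h
    subst hv
    have hmem : ∀ {e : Λ} {f : e ⟶ v'} {z : Bdry Λ × (Fin k → ℤ)},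
        (G.shift f).rel z (⟨v', C, hC⟩, n) → (⟨e, f⟩ : PathsTo v') ∈ C := by
      rintro e f z ⟨F, hF, n, -, h⟩
      simp only [Prod.mk.injEq, Sigma.mk.injEq, heq_eq_eq, true_and, Subtype.mk.injEq] at h
      rw [h.1]
      exact mem_cons f hF.toIsPathFilter
    obtain ⟨⟨c, x⟩, hx, ⟨γ, hγ⟩, ⟨δ, hδ⟩⟩ := hC.directed _ (hmem h2) _ (hmem h1)
    dsimp only at γ δ hγ hδ
    subst hγ
    obtain ⟨p, hp, ε, rfl, rfl⟩ := G.exists_mem_Lmin hδ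
    have hpC : (⟨p.1, p.2.1 ≫ l⟩ : PathsTo v') ∈ C := hC.down _ _ ⟨ε, by simp⟩ hx
    obtain ⟨w', h3⟩ : ∃ w', (G.shift (p.2.1 ≫ l)).rel w' (⟨v', C, hC⟩, n) :=
      ⟨_, exists_tail_rel hC hpC n⟩
    refine ⟨p, hp, _, ?_, shift_rel_of_comp h3 h2⟩
    rw [hp.1] at h3
    exact shift_rel_of_comp h3 h1
  · rintro ⟨p, hp, w', h1 : (G.shift p.2.2).rel _ _, h2⟩
    have hq : ∃ q, (G.shift l).rel y q := by
      obtain ⟨F, hF, n, -, rfl⟩ := h2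
      exact ⟨_, shift_rel_mk l _ _⟩
    obtain ⟨q, hq⟩ := hq
    have h3 := (shift_comp_rel_iff l p.2.1 w' q).1 ⟨y, h2, hq⟩
    rw [hp.1] at h3
    obtain ⟨z', h4, h5⟩ := (shift_comp_rel_iff m p.2.2 w' q).2 h3
    cases (G.shift p.2.2).functional h1 h4
    exact ⟨q, h5, hq⟩

/-- All first components of `Λ^min(l, m)` have degree `(d(l) ∨ d(m)) - d(l)`, and two paths of equal
degree in one filter coincide. This makes the ranges in the sum for `t_l⋆ t_m` disjoint. -/
theorem eq_of_shift_rel {a b v : Λ} {l : a ⟶ v} {m : b ⟶ v}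
    {p p' : Σ c : Λ, (c ⟶ a) × (c ⟶ b)} (hp : p ∈ G.Lmin l m) (hp' : p' ∈ G.Lmin l m)
    {z z' y : Bdry Λ × (Fin k → ℤ)} (h : (G.shift p.2.1).rel z y)
    (h' : (G.shift p'.2.1).rel z' y) : p = p' := by
  obtain ⟨F, hF, n, -, rfl⟩ := h
  obtain ⟨F', hF', n', -, h⟩ := h'
  simp only [Prod.mk.injEq, Sigma.mk.injEq, heq_eq_eq, true_and, Subtype.mk.injEq] at h
  have h1 := mem_cons p.2.1 hF.toIsPathFilter
  have h2 := mem_cons p'.2.1 hF'.toIsPathFilter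
  rw [← h.1] at h2
  obtain ⟨x, -, ⟨γ, hγ⟩, ⟨δ, hδ⟩⟩ :=
    (isPathFilter_cons p.2.1 hF.toIsPathFilter).directed _ h1 _ h2
  have hd : G.d p.2.1 = G.d p'.2.1 := by
    have e1 := hp.2
    have e2 := hp'.2
    rw [G.d_comp] at e1 e2
    exact add_right_cancel (e1.trans e2.symm)
  have key := G.factor_unique (hγ.symm.trans hδ) hd
  obtain ⟨c, α, β⟩ := p
  obtain ⟨c', α', β'⟩ := p'
  cases key
  have e1 := hp.1
  have e2 := hp'.1
  dsimp only at e1 e2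
  rw [e1] at e2
  rw [G.comp_right_cancel e2]

end Boundary

section Family

variable (G : KGraph k Λ)

/-- The operators on `ℓ²` of the boundary, graded by `ℤ ^ k`, that prefix with a path. -/
noncomputable def bdryFamily {a v : Λ} (l : a ⟶ v) :
    PInj.L2 (Bdry Λ × (Fin k → ℤ)) →L[ℂ] PInj.L2 (Bdry Λ × (Fin k → ℤ)) := (G.shift l).op

theorem bdryFamily_mul {a b c : Λ} (l : b ⟶ c) (m : a ⟶ b) :
    G.bdryFamily l * G.bdryFamily m = G.bdryFamily (m ≫ l) := by
  rw [bdryFamily, bdryFamily, PInj.op_mul_op]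
  exact PInj.op_congr (shift_comp_rel_iff l m)

theorem bdryFamily_star_id (v : Λ) : star (G.bdryFamily (𝟙 v)) = G.bdryFamily (𝟙 v) := by
  rw [bdryFamily, PInj.star_op]
  refine PInj.op_congr fun z y => ?_
  change (G.shift (𝟙 v)).rel y z ↔ _
  rw [shift_id_rel_iff, shift_id_rel_iff]
  constructor <;> rintro ⟨rfl, h⟩ <;> exact ⟨rfl, h⟩

theorem bdryFamily_star_mul (hG : G.FinitelyAligned) {a b v : Λ} (l : a ⟶ v) (m : b ⟶ v) :
    star (G.bdryFamily l) * G.bdryFamily m =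
      ∑ p ∈ (hG l m).toFinset, G.bdryFamily p.2.1 * star (G.bdryFamily p.2.2) := by
  simp only [bdryFamily, PInj.star_op, PInj.op_mul_op]
  refine PInj.op_eq_sum _ (fun p : Σ c : Λ, (c ⟶ a) × (c ⟶ b) =>
    (G.shift p.2.1).comp (G.shift p.2.2).symm) _ ?_ ?_
  · intro z y
    simp only [Set.Finite.mem_toFinset]
    exact shift_star_mul_rel_iff l m z y
  · rintro p hp p' hp' z z' y ⟨_, -, h⟩ ⟨_, -, h'⟩
    rw [Set.Finite.mem_toFinset] at hp hp'
    exact eq_of_shift_rel hp hp' h h'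

theorem bdryFamily_star_mul_of_ne {a b v v' : Λ} (l : a ⟶ v) (m : b ⟶ v') (h : v ≠ v') :
    star (G.bdryFamily l) * G.bdryFamily m = 0 := by
  simp only [bdryFamily, PInj.star_op, PInj.op_mul_op]
  refine PInj.op_eq_zero ?_
  rintro z y ⟨q, ⟨F, hF, n, -, rfl⟩, ⟨F', hF', n', -, h'⟩⟩
  exact h (congrArg (fun q => q.1.1) h').symm

theorem bdryFamily_mul_star_mul {a v : Λ} (l : a ⟶ v) :
    G.bdryFamily l * star (G.bdryFamily l) * G.bdryFamily l = G.bdryFamily l := by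
  simp only [bdryFamily, PInj.star_op, PInj.op_mul_op]
  refine PInj.op_congr fun z y => ?_
  constructor
  · rintro ⟨q, h1, ⟨z', h2, h3⟩⟩
    rwa [(G.shift l).injective h1 h2]
  · exact fun h => ⟨y, h, z, h, h⟩

theorem bdryFamily_ne_zero (v : Λ) : G.bdryFamily (𝟙 v) ≠ 0 := by
  obtain ⟨F, hF⟩ := exists_isMaxFilter v
  exact PInj.op_ne_zero (shift_rel_mk (G := G) (𝟙 v) hF 0)

-- `t_v - t_l t_l⋆` multiplies by the indicator of the filters at `v` that do not contain `l`, so a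
-- product of such operators can be evaluated point by point.
open Classical in
theorem bdryFamily_range_apply {a v : Λ} (l : a ⟶ v)
    (x : PInj.L2 (Bdry Λ × (Fin k → ℤ))) (y : Bdry Λ × (Fin k → ℤ)) :
    (G.bdryFamily (𝟙 v) - G.bdryFamily l * star (G.bdryFamily l)) x y =
      (if ∃ (F : Set (PathsTo v)) (hF : IsMaxFilter F), (⟨a, l⟩ : PathsTo v) ∉ F ∧
        y.1 = ⟨v, F, hF⟩ then 1 else 0) * x y := by
  simp only [bdryFamily, PInj.star_op, PInj.op_mul_op]
  change (G.shift (𝟙 v)).op x y - ((G.shift l).comp (G.shift l).symm).op x y = _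
  obtain ⟨⟨v', F, hF⟩, n⟩ := y
  by_cases hv : v' = v
  · subst hv
    rw [(G.shift (𝟙 v')).op_apply_of_rel x (shift_id_rel_iff.2 ⟨rfl, rfl⟩)]
    by_cases hl : (⟨a, l⟩ : PathsTo v') ∈ F
    · rw [PInj.op_apply_of_rel _ x ((shift_range_rel_iff l _ _).2 ⟨rfl, F, hF, hl, rfl⟩), if_neg]
      · simp
      · rintro ⟨F', hF', hl', h⟩
        cases h
        exact hl' hl
    · rw [PInj.op_apply_of_not, if_pos ⟨F, hF, hl, rfl⟩]
      · simp
      · rintro ⟨z, hz⟩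
        obtain ⟨-, F', hF', hl', h⟩ := (shift_range_rel_iff l _ _).1 hz
        cases h
        exact hl hl'
  · rw [PInj.op_apply_of_not, PInj.op_apply_of_not, if_neg]
    · simp
    · rintro ⟨F', hF', hl', h⟩
      exact hv (congrArg Sigma.fst h)
    · rintro ⟨z, hz⟩
      obtain ⟨-, F', hF', hl', h⟩ := (shift_range_rel_iff l _ _).1 hz
      exact hv (congrArg Sigma.fst h)
    · rintro ⟨z, hz⟩
      obtain ⟨rfl, h⟩ := shift_id_rel_iff.1 hz
      exact hv h

/-- At a filter with range `v`, the factor of a member of `E` lying in the filter vanishes. At any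
other vertex all factors vanish, and `E` is nonempty because some member meets `𝟙 v`. -/
theorem bdryFamily_prod_eq_zero (hG : G.FinitelyAligned) (v : Λ) (E : List (PathsTo v))
    (hE : G.IsExhaustive {l | l ∈ E}) :
    (E.map fun l => G.bdryFamily (𝟙 v) - G.bdryFamily l.2 * star (G.bdryFamily l.2)).prod = 0 := by
  classical
  refine PInj.ext_op fun x y => ?_
  have key : ∀ (L : List (PathsTo v)), (∃ l ∈ L, ¬ ∃ (F : Set (PathsTo v)) (hF : IsMaxFilter F),
      l ∉ F ∧ y.1 = ⟨v, F, hF⟩) →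
      (L.map fun l => G.bdryFamily (𝟙 v) - G.bdryFamily l.2 * star (G.bdryFamily l.2)).prod x y =
        0 := by
    intro L
    induction L with
    | nil => simp
    | cons l L ih =>
      rintro ⟨m, hm, hmy⟩
      rw [List.map_cons, List.prod_cons]
      change (G.bdryFamily (𝟙 v) - G.bdryFamily l.2 * star (G.bdryFamily l.2))
        ((L.map fun l =>
          G.bdryFamily (𝟙 v) - G.bdryFamily l.2 * star (G.bdryFamily l.2)).prod x) y = 0
      rw [bdryFamily_range_apply]
      rcases List.mem_cons.1 hm with rfl | hm
      · rw [if_neg hmy, zero_mul]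
      · rw [ih ⟨m, hm, hmy⟩, mul_zero]
  refine key E ?_
  obtain ⟨⟨v', F, hF⟩, n⟩ := y
  by_cases hv : v' = v
  · subst hv
    obtain ⟨l, hl, hlF⟩ := hF.exists_mem_of_isExhaustive hG E hE
    refine ⟨l, hl, ?_⟩
    rintro ⟨F', hF', hl', h⟩
    cases h
    exact hl' hlF
  · obtain ⟨l, hl, -⟩ := hE ⟨v, 𝟙 v⟩
    refine ⟨l, hl, ?_⟩
    rintro ⟨F', hF', hl', h⟩
    exact hv (congrArg Sigma.fst h)

/-- The empty product must be excluded: the unit of the unitization is not the image of the unit of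
`A`. -/
theorem prod_inr {A ι : Type*} [CStarAlgebra A] (f : ι → A) {L : List ι} (hL : L ≠ []) :
    (L.map fun i => (f i : Unitization ℂ A)).prod = ((L.map f).prod : A) := by
  induction L with
  | nil => exact absurd rfl hL
  | cons i L ih =>
    by_cases h : L = []
    · simp [h]
    · rw [List.map_cons, List.prod_cons, ih h, ← Unitization.inr_mul, List.map_cons,
        List.prod_cons]

theorem isCKFamily_bdryFamily (hG : G.FinitelyAligned) :
    G.IsCKFamily hG (fun {u v} (l : u ⟶ v) => G.bdryFamily l) where
  partialIsometry l := G.bdryFamily_mul_star_mul l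
  projection v := ⟨by
    rw [IsIdempotentElem, bdryFamily_mul, Category.id_comp], G.bdryFamily_star_id v⟩
  orthogonal v v' h := by
    rw [← bdryFamily_star_id, G.bdryFamily_star_mul_of_ne _ _ h]
  mul l m := G.bdryFamily_mul l m
  star_mul l m := G.bdryFamily_star_mul hG l m
  star_mul_of_ne l m h := G.bdryFamily_star_mul_of_ne l m h
  prod_eq_zero v E _ hE := by
    have hne : E ≠ [] := by
      obtain ⟨l, hl, -⟩ := hE ⟨v, 𝟙 v⟩
      exact List.ne_nil_of_mem hl
    rw [prod_inr _ hne, G.bdryFamily_prod_eq_zero hG v E hE, Unitization.inr_zero]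

theorem hasGaugeAction_bdryFamily :
    G.HasGaugeAction (fun {u v} (l : u ⟶ v) => G.bdryFamily l) := by
  -- The weight is `z ^ n` at grading `n`. Prefixing by `l` adds `d(l)` to the grading and so
  -- multiplies the weight by `z ^ d(l)`.
  let χ : (Fin k → Circle) →* (Bdry Λ × (Fin k → ℤ) → Circle) :=
    { toFun := fun z y => ∏ i, z i ^ y.2 i
      map_one' := by ext y; simp
      map_mul' := by
        intro z z'
        funext y
        simp [mul_zpow, Finset.prod_mul_distrib] }
  refine hasGaugeAction_of_ambient
    (((Unitary.conjStarAlgAut ℂ _).comp PInj.diagUnitary).comp χ) fun z a b l => ?_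
  refine PInj.conj_op (G.shift l) (χ z) _ ?_
  rintro _ _ ⟨F, hF, n, rfl, rfl⟩
  have hcoe : ∀ f : Fin k → Circle, ((∏ i, f i : Circle) : ℂ) = ∏ i, (f i : ℂ) := fun f =>
    map_prod Circle.coeHom f _
  refine (hcoe fun i => z i ^ (n + G.degZ l) i).trans
    (Eq.trans ?_ (congrArg (_ * ·) (hcoe fun i => z i ^ n i).symm))
  rw [← Finset.prod_mul_distrib]
  refine Finset.prod_congr rfl fun i _ => ?_
  rw [Circle.coe_zpow, Circle.coe_zpow, Pi.add_apply, zpow_add₀ (Circle.coe_ne_zero _), mul_comm]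
  congr 1

end Family

end KGraph

theorem corollary4p3 {k : ℕ} {Λ : Type u} [Category.{w} Λ]
    (G : KGraph k Λ) (hG : G.FinitelyAligned) :
    -- existence
    (∃ (A : Type (max u w)) (_ : NonUnitalCStarAlgebra A) (t : ∀ {u v : Λ}, (u ⟶ v) → A),
      G.IsCKFamily hG t ∧ (∀ v : Λ, t (𝟙 v) ≠ 0) ∧ G.HasGaugeAction t) ∧
    -- uniqueness
    (∀ (A : Type x) [NonUnitalCStarAlgebra A] (B : Type y) [NonUnitalCStarAlgebra B]
      (t : ∀ {u v : Λ}, (u ⟶ v) → A) (t' : ∀ {u v : Λ}, (u ⟶ v) → B),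
      G.IsCKFamily hG t → (∀ v : Λ, t (𝟙 v) ≠ 0) → G.HasGaugeAction t →
      G.IsCKFamily hG t' → (∀ v : Λ, t' (𝟙 v) ≠ 0) → G.HasGaugeAction t' →
      ∃ φ : KGraph.generated t ≃⋆ₐ[ℂ] KGraph.generated t',
        ∀ {a b : Λ} (l : a ⟶ b), φ (KGraph.gen t l) = KGraph.gen t' l) := by
  refine ⟨⟨_, inferInstance, fun {u v} (l : u ⟶ v) => G.bdryFamily l, G.isCKFamily_bdryFamily hG,
    G.bdryFamily_ne_zero, G.hasGaugeAction_bdryFamily⟩, ?_⟩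
  intro A _ B _ t t' ht hne hgauge ht' hne' hgauge'
  exact KGraph.exists_starAlgEquiv ht hne hgauge ht' hne' hgauge'
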